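/- Let $(M,g)$ be an oriented four-dimensional smooth spacetime with metric $g$ of signature $(-,+,+,+)$, Levi-Civita connection $\nabla$, volume element $\eta$ and Hodge dual $*$. Write $(x,y)=g(x,y)$; for 2-forms put $(F,G)=\tfrac12F_{\alpha\beta}G^{\alpha\beta}$, extended complex-bilinearly, and $(\ell\wedge e)_{\alpha\beta}=\ell_\alpha e_\beta-\ell_\beta e_\alpha$. Let $Ric$ be the Ricci tensor, $r$ its trace, $Q=\tfrac12\left(Ric-\tfrac r6\,g\right)$, and $W$ the Weyl tensor. Let $U\subseteq M$ be open and suppose that on $U$ the Weyl tensor is of Petrov–Bel type N: $\mathcal W=\tfrac12(W-\mathrm i*W)$ satisfies $\mathcal W\neq0$ and $\mathcal W^2=0$, where $(\mathcal W^2)_{\alpha\beta\mu\nu}=\tfrac12\mathcal W_{\alpha\beta\lambda\rho}\mathcal W^{\lambda\rho}{}_{\mu\nu}$. Let $\mathcal L=\tfrac1{\sqrt2}(L-\mathrm i*L)$ and $\ell$ be smooth fields on $U$ of its fundamental bivector and fundamental vector: $L$ is a real null 2-form ($(L,L)=(*L,L)=0$) with $\mathcal W=\mathcal L\otimes\mathcal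 L$, and $\ell\neq0$ is a null vector with $L(\ell)=*L(\ell)=0$ and $L=\ell\wedge e_2$ for some unit space-like vector $e_2$ orthogonal to $\ell$ (this fixes $\ell$ up to sign). For a time-like vector $x$ define $$a_\alpha=-\frac{1}{(\ell,x)}\,x^\beta\ell^\mu\nabla_\alpha L_{\beta\mu},\qquad a^*_\alpha=\frac{1}{(\ell,x)}\,x^\beta\ell^\mu\nabla_\alpha(*L)_{\beta\mu},$$ $$\varphi_1=(\nabla_\ell\mathcal L,\nabla_\ell\mathcal L),\qquad \varphi_2=|(\nabla_a\mathcal L,\nabla_a\mathcal L)|+|(\nabla_{a^*}\mathcal L,\nabla_{a^*}\mathcal L)|.$$ Suppose that the metric belongs on $U$ to the family $\widehat{\mathrm C2}$, that is, $\varphi_1=\varphi_2=0$ on $U$ (for every time-like $x$); equivalently, $\ell$ is geodesic, shear-free, non-twisting and non-diverging. Then at every point of $U$ the vector $\ell$ is an eigenvector of $Q$, and hence of the Ricci tensor: for every time-like vector $x$ one has $(\ell,x)\neq0$ and $$Q(\ell)=\lambda\,\ell,\qquad \lambda=\frac{Q(\ell,x)}{(\ell,x)},\qquad Ric(\ell)=\left(2\lambda+\frac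 r6\right)\ell .$$ -/

import Mathlib

open scoped Manifold ContDiff

noncomputable section

namespace TypeNSpacetime

/-- The coordinate space. -/
abbrev E4 : Type := EuclideanSpace ℝ (Fin 4)

/-- Index arrays with two and four indices. -/
abbrev Arr2 (F : Type) : Type := Fin 4 → Fin 4 → F
abbrev Arr4 (F : Type) : Type := Fin 4 → Fin 4 → Fin 4 → Fin 4 → F

/-! ### Tensor calculus in one coordinate system

`g` is the matrix of covariant components of the metric, as a function of the coordinates. -/

section Coordinates

/-- The partial derivative `∂ₖ f` at the point `y`. -/
def pd {F : Type} [NormedAddCommGroup F] [NormedSpace ℝ F] (k : Fin 4) (f : E4 → F) (y : E4) : F :=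
  fderiv ℝ f y (EuclideanSpace.single k 1)

/-- The Christoffel symbols `Γᵏᵢⱼ` of the Levi-Civita connection. -/
def christoffel (g : E4 → Matrix (Fin 4) (Fin 4) ℝ) (k i j : Fin 4) (y : E4) : ℝ :=
  (1 / 2) * ∑ m, (g y)⁻¹ k m *
    (pd i (fun z => g z j m) y + pd j (fun z => g z i m) y - pd m (fun z => g z i j) y)

/-- The Riemann tensor `Rᵃ_{bcd}`, that is `R(∂_c, ∂_d) ∂_b = Rᵃ_{bcd} ∂_a` for
`R(X, Y) = ∇_X ∇_Y - ∇_Y ∇_X - ∇_[X, Y]`. -/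
def riemannUp (g : E4 → Matrix (Fin 4) (Fin 4) ℝ) (a b c d : Fin 4) (y : E4) : ℝ :=
  pd c (christoffel g a d b) y - pd d (christoffel g a c b) y
    + ∑ m, (christoffel g a c m y * christoffel g m d b y
          - christoffel g a d m y * christoffel g m c b y)

/-- The Riemann tensor `R_{abcd}`. -/
def riemann (g : E4 → Matrix (Fin 4) (Fin 4) ℝ) (y : E4) : Arr4 ℝ := fun a b c d =>
  ∑ m, g y a m * riemannUp g m b c d y

/-- The Ricci tensor `Ric_{bd} = Rᵃ_{bad}`. -/
def ricci (g : E4 → Matrix (Fin 4) (Fin 4) ℝ) (y : E4) : Arr2 ℝ := fun b d =>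
  ∑ a, riemannUp g a b a d y

/-- The scalar curvature `r`, the trace of the Ricci tensor. -/
def scalarCurv (g : E4 → Matrix (Fin 4) (Fin 4) ℝ) (y : E4) : ℝ :=
  ∑ b, ∑ d, (g y)⁻¹ b d * ricci g y b d

/-- The tensor `Q` with `2 Q = Ric - (r / 6) g`. -/
def schouten (g : E4 → Matrix (Fin 4) (Fin 4) ℝ) (y : E4) : Arr2 ℝ := fun a b =>
  (1 / 2) * (ricci g y a b - scalarCurv g y / 6 * g y a b)

/-- The Weyl tensor: the Riemann tensor minus the double 2-form `g ∧ Q`. -/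
def weyl (g : E4 → Matrix (Fin 4) (Fin 4) ℝ) (y : E4) : Arr4 ℝ := fun a b c d =>
  riemann g y a b c d
    - (g y a c * schouten g y b d + g y b d * schouten g y a c
      - g y a d * schouten g y b c - g y b c * schouten g y a d)

/-- The covariant derivative `∇ₖ T_{ij}` of a (real or complex) covariant 2-tensor field. -/
def covDeriv {F : Type} [NormedAddCommGroup F] [NormedSpace ℝ F]
    (g : E4 → Matrix (Fin 4) (Fin 4) ℝ) (T : E4 → Arr2 F) (y : E4) (k i j : Fin 4) : F :=
  pd k (fun z => T z i j) y
    - ∑ m, (christoffel g m k i y • T y m j + christoffel g m k j y • T y i m)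

end Coordinates

/-! ### Algebra at one point

`g` is the matrix of the metric at the point and `η` the array of components of the metric volume
element at the point. -/

section Algebra

/-- `T(v, w) = T_{ij} vⁱ wʲ`. -/
def pair (T : Arr2 ℝ) (v w : Fin 4 → ℝ) : ℝ := ∑ i, ∑ j, T i j * v i * w j

/-- `T(v)ᵢ = T_{ij} vʲ`; for `T = g` this lowers the index of `v`. -/
def app (T : Arr2 ℝ) (v : Fin 4 → ℝ) (i : Fin 4) : ℝ := ∑ j, T i j * v j

/-- `vⁱ = g^{ij} vⱼ`. -/
def raise (g : Matrix (Fin 4) (Fin 4) ℝ) (v : Fin 4 → ℝ) (i : Fin 4) : ℝ := ∑ j, g⁻¹ i j * v j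

/-- `F^{ij} = g^{ia} g^{jb} F_{ab}`. -/
def raise2 {F : Type} [AddCommGroup F] [Module ℝ F] (g : Matrix (Fin 4) (Fin 4) ℝ) (T : Arr2 F) :
    Arr2 F := fun i j => ∑ a, ∑ b, (g⁻¹ i a * g⁻¹ j b) • T a b

/-- The Hodge dual `(*F)_{ab} = ½ η_{abcd} F^{cd}` of a 2-form. -/
def hodge (g : Matrix (Fin 4) (Fin 4) ℝ) (η : Arr4 ℝ) (T : Arr2 ℝ) : Arr2 ℝ := fun a b =>
  (1 / 2) * ∑ c, ∑ d, η a b c d * raise2 g T c d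

/-- The metric `(F, L) = ¼ G_{αβμν} F^{αβ} L^{μν}`, `G = ½ g ∧ g`, on real 2-forms, that is
`½ F_{αβ} L^{αβ}`. -/
def form2 (g : Matrix (Fin 4) (Fin 4) ℝ) (S T : Arr2 ℝ) : ℝ :=
  (1 / 2) * ∑ a, ∑ b, S a b * raise2 g T a b

/-- The complex bilinear extension of `form2` to complex 2-forms. -/
def form2C (g : Matrix (Fin 4) (Fin 4) ℝ) (S T : Arr2 ℂ) : ℂ :=
  (1 / 2) * ∑ a, ∑ b, S a b * raise2 g T a b

/-- The bivector (self-dual 2-form) `(F - i *F) / √2` of a real 2-form `F`. -/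
def bivector (g : Matrix (Fin 4) (Fin 4) ℝ) (η : Arr4 ℝ) (T : Arr2 ℝ) : Arr2 ℂ := fun a b =>
  ((T a b : ℂ) - Complex.I * (hodge g η T a b : ℂ)) / ((Real.sqrt 2 : ℝ) : ℂ)

/-- The self-dual double 2-form `½ (W - i *W)`, where `(*W)_{abcd} = ½ η_{abmn} W^{mn}_{cd}`. -/
def selfDual (g : Matrix (Fin 4) (Fin 4) ℝ) (η : Arr4 ℝ) (W : Arr4 ℝ) : Arr4 ℂ := fun a b c d =>
  (1 / 2) * ((W a b c d : ℂ) - Complex.I * (hodge g η (fun m n => W m n c d) a b : ℂ))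

/-- `(𝒲²)_{abcd} = ½ 𝒲_{abmn} 𝒲^{mn}_{cd}`. -/
def dblSq (g : Matrix (Fin 4) (Fin 4) ℝ) (W : Arr4 ℂ) : Arr4 ℂ := fun a b c d =>
  (1 / 2) * ∑ m, ∑ n, W a b m n * raise2 g (fun p q => W p q c d) m n

/-- A Weyl tensor `W` is of (Petrov-Bel) type N: its self-dual part does not vanish and squares
to zero. -/
def IsTypeN (g : Matrix (Fin 4) (Fin 4) ℝ) (η : Arr4 ℝ) (W : Arr4 ℝ) : Prop :=
  selfDual g η W ≠ 0 ∧ dblSq g (selfDual g η W) = 0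

/-- `ℓ` is the fundamental vector of the null 2-form `L`, up to the sign that a time orientation
fixes: `ℓ` is null and annihilated by `L` and `*L`, and `L = ℓ ∧ e₂` for a unit space-like
vector `e₂` orthogonal to `ℓ`. -/
structure IsFundamentalVector (g : Matrix (Fin 4) (Fin 4) ℝ) (η : Arr4 ℝ) (L : Arr2 ℝ)
    (l : Fin 4 → ℝ) : Prop where
  null_form : form2 g L L = 0 ∧ form2 g (hodge g η L) L = 0
  ne_zero : l ≠ 0
  null : pair g l l = 0
  ker : app L l = 0
  ker_dual : app (hodge g η L) l = 0
  normalised : ∃ e₂ : Fin 4 → ℝ, pair g e₂ e₂ = 1 ∧ pair g l e₂ = 0 ∧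
    ∀ i j, L i j = app g l i * app g e₂ j - app g l j * app g e₂ i

/-- `ℒ = (L - i *L) / √2` and `ℓ` are the fundamental bivector and the fundamental vector of the
Weyl tensor `W`: `½ (W - i *W) = ℒ ⊗ ℒ`, and `ℓ` is the fundamental vector of `L`. -/
def IsFundamental (g : Matrix (Fin 4) (Fin 4) ℝ) (η : Arr4 ℝ) (W : Arr4 ℝ) (L : Arr2 ℝ)
    (l : Fin 4 → ℝ) : Prop :=
  IsFundamentalVector g η L l ∧
    ∀ a b c d, selfDual g η W a b c d = bivector g η L a b * bivector g η L c d

end Algebra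

/-! ### The invariants `φ₁` and `φ₂` in one coordinate system -/

section Invariants

/-- `∇_v ℒ` at `y`, where `ℒ = (L - i *L) / √2`. -/
def nablaBiv (g : E4 → Matrix (Fin 4) (Fin 4) ℝ) (η : E4 → Arr4 ℝ) (L : E4 → Arr2 ℝ)
    (v : Fin 4 → ℝ) (y : E4) : Arr2 ℂ := fun i j =>
  ∑ k, v k • covDeriv g (fun z => bivector (g z) (η z) (L z)) y k i j

/-- The covector `a = -(1 / (ℓ, x)) (∇L · ℓ)(x)`. -/
def aForm (g : E4 → Matrix (Fin 4) (Fin 4) ℝ) (L : E4 → Arr2 ℝ)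
    (l : E4 → Fin 4 → ℝ) (y : E4) (x : Fin 4 → ℝ) : Fin 4 → ℝ := fun k =>
  -(1 / pair (g y) (l y) x) * ∑ i, ∑ j, covDeriv g L y k i j * l y j * x i

/-- The covector `a* = (1 / (ℓ, x)) (∇*L · ℓ)(x)`. -/
def aStarForm (g : E4 → Matrix (Fin 4) (Fin 4) ℝ) (η : E4 → Arr4 ℝ) (L : E4 → Arr2 ℝ)
    (l : E4 → Fin 4 → ℝ) (y : E4) (x : Fin 4 → ℝ) : Fin 4 → ℝ := fun k =>
  (1 / pair (g y) (l y) x) *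
    ∑ i, ∑ j, covDeriv g (fun z => hodge (g z) (η z) (L z)) y k i j * l y j * x i

/-- `φ₁ = (ℱ₁, ℱ₁)` with `ℱ₁ = ∇_ℓ ℒ`. -/
def phi1 (g : E4 → Matrix (Fin 4) (Fin 4) ℝ) (η : E4 → Arr4 ℝ) (L : E4 → Arr2 ℝ)
    (l : E4 → Fin 4 → ℝ) (y : E4) : ℂ :=
  form2C (g y) (nablaBiv g η L (l y) y) (nablaBiv g η L (l y) y)

/-- `φ₂ = |(ℱ₂, ℱ₂)| + |(ℱ₂*, ℱ₂*)|` with `ℱ₂ = ∇_a ℒ` and `ℱ₂* = ∇_{a*} ℒ`, the vectors `a` and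
`a*` being formed with the auxiliary time-like vector `x`. -/
def phi2 (g : E4 → Matrix (Fin 4) (Fin 4) ℝ) (η : E4 → Arr4 ℝ) (L : E4 → Arr2 ℝ)
    (l : E4 → Fin 4 → ℝ) (y : E4) (x : Fin 4 → ℝ) : ℝ :=
  let f2 := nablaBiv g η L (raise (g y) (aForm g L l y x)) y
  let f2s := nablaBiv g η L (raise (g y) (aStarForm g η L l y x)) y
  ‖form2C (g y) f2 f2‖ + ‖form2C (g y) f2s f2s‖

end Invariants

/-! ### Spacetimes -/

section Manifold

variable {M : Type*} [TopologicalSpace M] [ChartedSpace E4 M]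

/-- The coordinate vector `∂ᵢ` of the chart `e` at the point with coordinates `y`. -/
def coordVec (e : OpenPartialHomeomorph M E4) (y : E4) (i : Fin 4) :
    TangentSpace 𝓘(ℝ, E4) (e.symm y) :=
  mfderiv 𝓘(ℝ, E4) 𝓘(ℝ, E4) e.symm y (EuclideanSpace.single i (1 : ℝ) : E4)

/-- A (not necessarily continuous) field of bilinear forms on the tangent spaces. -/
abbrev BilinField (M : Type*) [TopologicalSpace M] [ChartedSpace E4 M] : Type _ :=
  (p : M) → TangentSpace 𝓘(ℝ, E4) p →ₗ[ℝ] TangentSpace 𝓘(ℝ, E4) p →ₗ[ℝ] ℝ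

/-- A (not necessarily continuous) vector field. -/
abbrev VecField (M : Type*) [TopologicalSpace M] [ChartedSpace E4 M] : Type _ :=
  (p : M) → TangentSpace 𝓘(ℝ, E4) p

/-- A (not necessarily continuous) field of alternating 4-forms. -/
abbrev FourForm (M : Type*) [TopologicalSpace M] [ChartedSpace E4 M] : Type _ :=
  (p : M) → TangentSpace 𝓘(ℝ, E4) p [⋀^Fin 4]→ₗ[ℝ] ℝ

/-- The components `T(∂ᵢ, ∂ⱼ)` in the chart `e`. -/
def comp2 (T : BilinField M) (e : OpenPartialHomeomorph M E4) (y : E4) :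
    Matrix (Fin 4) (Fin 4) ℝ :=
  fun i j => T (e.symm y) (coordVec e y i) (coordVec e y j)

/-- The components `η(∂ᵢ, ∂ⱼ, ∂ₖ, ∂ₘ)` in the chart `e`. -/
def comp4 (η : FourForm M) (e : OpenPartialHomeomorph M E4) (y : E4) : Arr4 ℝ :=
  fun i j k m => η (e.symm y) ![coordVec e y i, coordVec e y j, coordVec e y k, coordVec e y m]

/-- The components `vⁱ = dyⁱ(v)` in the chart `e`. -/
def compV (v : VecField M) (e : OpenPartialHomeomorph M E4) (y : E4) : Fin 4 → ℝ :=
  fun i => (show E4 from mfderiv 𝓘(ℝ, E4) 𝓘(ℝ, E4) e (e.symm y) (v (e.symm y))) i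

/-- An oriented four-dimensional spacetime structure on `M`: a smooth metric of signature
`(-,+,+,+)` and a smooth volume element of it. -/
structure Spacetime (M : Type*) [TopologicalSpace M] [ChartedSpace E4 M]
    [IsManifold 𝓘(ℝ, E4) ∞ M] where
  /-- the metric -/
  g : BilinField M
  /-- the metric volume element -/
  vol : FourForm M
  lorentzian : ∀ p, ∃ b : Module.Basis (Fin 4) ℝ (TangentSpace 𝓘(ℝ, E4) p), ∀ i j,
    g p (b i) (b j) = Matrix.diagonal ![(-1 : ℝ), 1, 1, 1] i j
  vol_sq : ∀ p (b : Module.Basis (Fin 4) ℝ (TangentSpace 𝓘(ℝ, E4) p)),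
    (∀ i j, g p (b i) (b j) = Matrix.diagonal ![(-1 : ℝ), 1, 1, 1] i j) → (vol p b) ^ 2 = 1
  smooth_g : ∀ e ∈ IsManifold.maximalAtlas 𝓘(ℝ, E4) ∞ M, ∀ i j,
    ContDiffOn ℝ ∞ (fun y => comp2 g e y i j) e.target
  smooth_vol : ∀ e ∈ IsManifold.maximalAtlas 𝓘(ℝ, E4) ∞ M, ∀ i j k m,
    ContDiffOn ℝ ∞ (fun y => comp4 vol e y i j k m) e.target

variable [IsManifold 𝓘(ℝ, E4) ∞ M]

/-- `ℒ = (L - i *L) / √2` and `ℓ` are, on the set `U`, smooth fields of fundamental bivectors and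
fundamental vectors of the Weyl tensor. -/
structure IsFundamentalOn (S : Spacetime M) (U : Set M) (L : BilinField M) (l : VecField M) :
    Prop where
  smooth_form : ∀ e ∈ IsManifold.maximalAtlas 𝓘(ℝ, E4) ∞ M, ∀ i j,
    ContDiffOn ℝ ∞ (fun y => comp2 L e y i j) (e.target ∩ e.symm ⁻¹' U)
  smooth_vec : ∀ e ∈ IsManifold.maximalAtlas 𝓘(ℝ, E4) ∞ M, ∀ i,
    ContDiffOn ℝ ∞ (fun y => compV l e y i) (e.target ∩ e.symm ⁻¹' U)
  fundamental : ∀ e ∈ IsManifold.maximalAtlas 𝓘(ℝ, E4) ∞ M, ∀ y ∈ e.target ∩ e.symm ⁻¹' U,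
    IsFundamental (comp2 S.g e y) (comp4 S.vol e y) (weyl (comp2 S.g e) y) (comp2 L e y)
      (compV l e y)

/-- On the set `U`, the metric is of type N and belongs to the family `Ĉ2`, that is
`φ₁ = φ₂ = 0`; here `φ₁` and `φ₂` are formed with the fundamental fields `L` and `ℓ`. -/
def InFamilyC2 (S : Spacetime M) (U : Set M) (L : BilinField M) (l : VecField M) : Prop :=
  ∀ e ∈ IsManifold.maximalAtlas 𝓘(ℝ, E4) ∞ M, ∀ y ∈ e.target ∩ e.symm ⁻¹' U,
    IsTypeN (comp2 S.g e y) (comp4 S.vol e y) (weyl (comp2 S.g e) y) ∧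
    phi1 (comp2 S.g e) (comp4 S.vol e) (comp2 L e) (compV l e) y = 0 ∧
    ∀ x, pair (comp2 S.g e y) x x < 0 →
      phi2 (comp2 S.g e) (comp4 S.vol e) (comp2 L e) (compV l e) y x = 0

end Manifold

end TypeNSpacetime

end

open TypeNSpacetime

/-!
No Bianchi identity beyond the first is needed: the statement is the analogue of the
Newman-Penrose equations in which `κ = σ = ρ = 0` forces `Φ₀₀ = Φ₀₁ = 0` once `Ψ₀ = Ψ₁ = 0`.

At each point there is a null frame `(ℓ, n, e₂, e₃)` with `L = ℓ ∧ e₂` and `*L = -ε ℓ ∧ e₃`, `ε ≠ 0`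
(`exists_isAdapted`). Differentiating the linear relations `L(ℓ) = 0`, `ℓ ∧ L = 0` and those for
`*L` determines the scalar product of `∇ᵥℒ` with itself in terms of `(∇ᵥℓ, e₂)` and `(∇ᵥℓ, e₃)`;
if it vanishes, so do both of these (`IsAdapted.components_eq_zero`). Thus `φ₁ = 0` says that `ℓ` is
geodesic. The covectors `a = (∇ℓ, e₂)` and `a* = ε (∇ℓ, e₃)` are then orthogonal to `ℓ`, and
`φ₂ = 0` makes them null, hence proportional to `ℓ`. So `∇_X ℓ` is proportional to `ℓ` for every `X`
orthogonal to `ℓ` (`pair_along_nablaVec_eq_zero`), or `∇ℓ = ℓ ⊗ P + q ⊗ ℓ`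
(`eq_mul_add_mul_of_frame`).

By the Ricci identity, `R(X, Y)ℓ` is proportional to `ℓ` for `X`, `Y` orthogonal to `ℓ`
(`exists_sum_riemannUp_mul_eq`). Since `W = L ⊗ L - *L ⊗ *L` annihilates `ℓ`, the decomposition of
the curvature leaves `(Z, X) Q(Y, ℓ) = (Z, Y) Q(X, ℓ)` for all `X`, `Y`, `Z` orthogonal to `ℓ`
(`pair_mul_sub_eq_zero`). Taking for `X = Z` a unit vector orthogonal to `Y` gives `Q(Y, ℓ) = 0`, so
that `Q(ℓ)` is a multiple of `ℓ`. The symmetry of `Q` in coordinates comes from the first Bianchi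
identity and the antisymmetry of `W` in its first two indices (`ricci_symm`).
-/

open scoped Manifold ContDiff

noncomputable section

namespace TypeNSpacetime

/-! ### Null frames of a Lorentzian scalar product -/

section Pairing

variable (T : Arr2 ℝ) (u v w : Fin 4 → ℝ) (c : ℝ)

theorem pair_add_left : pair T (u + v) w = pair T u w + pair T v w := by
  simp only [pair, Pi.add_apply, mul_add, add_mul, Finset.sum_add_distrib]

theorem pair_add_right : pair T u (v + w) = pair T u v + pair T u w := by
  simp only [pair, Pi.add_apply, mul_add, Finset.sum_add_distrib]

theorem pair_smul_left : pair T (c • u) v = c * pair T u v := by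
  simp only [pair, Pi.smul_apply, smul_eq_mul, Finset.mul_sum]
  exact Finset.sum_congr rfl fun i _ => Finset.sum_congr rfl fun j _ => by ring

theorem pair_smul_right : pair T u (c • v) = c * pair T u v := by
  simp only [pair, Pi.smul_apply, smul_eq_mul, Finset.mul_sum]
  exact Finset.sum_congr rfl fun i _ => Finset.sum_congr rfl fun j _ => by ring

theorem pair_comm {T : Arr2 ℝ} (hT : ∀ i j, T i j = T j i) (u v : Fin 4 → ℝ) :
    pair T u v = pair T v u := by
  simp only [pair]
  rw [Finset.sum_comm]
  exact Finset.sum_congr rfl fun i _ => Finset.sum_congr rfl fun j _ => by rw [hT j i]; ring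

theorem pair_eq_sum_app : pair T u v = ∑ i, u i * app T v i := by
  simp only [pair, app, Finset.mul_sum]
  exact Finset.sum_congr rfl fun i _ => Finset.sum_congr rfl fun j _ => by ring

theorem mul_mul_transpose_apply (E : Arr2 ℝ) (i j : Fin 4) :
    (Matrix.of E * Matrix.of T * (Matrix.of E).transpose) i j
      = pair T (E i) (E j) := by
  simp only [Matrix.mul_apply, Matrix.of_apply, Matrix.transpose_apply, pair, Finset.sum_mul]
  rw [Finset.sum_comm]
  exact Finset.sum_congr rfl fun i _ => Finset.sum_congr rfl fun j _ => by ring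

end Pairing

/-- The Gram matrix of a null frame `(ℓ, n, e₂, e₃)`: `ℓ` and `n` are null with `(ℓ, n) = 1`, and
`e₂`, `e₃` are orthonormal and orthogonal to both. -/
def nullGram : Matrix (Fin 4) (Fin 4) ℝ := !![0, 1, 0, 0; 1, 0, 0, 0; 0, 0, 1, 0; 0, 0, 0, 1]

/-- The rows of `E` form a null frame of the metric `g`. -/
def IsNullFrame (g : Matrix (Fin 4) (Fin 4) ℝ) (E : Arr2 ℝ) : Prop :=
  ∀ i j, pair g (E i) (E j) = nullGram i j

/-- A symmetric scalar product for which some vector is time-like, with a positive definite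
orthogonal complement. -/
structure IsLorentzian (g : Matrix (Fin 4) (Fin 4) ℝ) : Prop where
  symm : ∀ i j, g i j = g j i
  timelike : ∃ x, pair g x x < 0 ∧ ∀ v, pair g v x = 0 → v ≠ 0 → 0 < pair g v v

theorem exists_nullFrame {g : Matrix (Fin 4) (Fin 4) ℝ} (hg : IsLorentzian g) {l e : Fin 4 → ℝ}
    (hl0 : l ≠ 0) (hl : pair g l l = 0) (he : pair g e e = 1) (hle : pair g l e = 0) :
    ∃ E : Arr2 ℝ, IsNullFrame g E ∧ E 0 = l ∧ E 2 = e := by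
  obtain ⟨x, hx, hpos⟩ := hg.timelike
  have hcomm := pair_comm hg.symm
  have hs : pair g l x ≠ 0 := fun h => (hpos l h hl0).ne' hl
  -- a dimension count gives `e₃`; being orthogonal to the time-like `x`, it is space-like
  obtain ⟨v, hv0, hvl, hvx, hve⟩ : ∃ v : Fin 4 → ℝ, v ≠ 0 ∧ pair g v l = 0 ∧ pair g v x = 0 ∧
      pair g v e = 0 := by
    let f : (Fin 4 → ℝ) →ₗ[ℝ] (Fin 3 → ℝ) :=
      { toFun := fun v => ![pair g v l, pair g v x, pair g v e]
        map_add' := fun u v => by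
          ext i; fin_cases i <;> simp [pair_add_left g]
        map_smul' := fun c v => by
          ext i; fin_cases i <;> simp [pair_smul_left g] }
    have hker : LinearMap.ker f ≠ ⊥ := LinearMap.ker_ne_bot_of_finrank_lt (by simp)
    obtain ⟨v, hv, hv0⟩ := (Submodule.ne_bot_iff _).1 hker
    have hv' : ![pair g v l, pair g v x, pair g v e] = 0 := hv
    exact ⟨v, hv0, by simpa using congrFun hv' 0, by simpa using congrFun hv' 1,
      by simpa using congrFun hv' 2⟩
  have hvv := hpos v hvx hv0
  obtain ⟨r, hr⟩ : ∃ r : ℝ, r * r * pair g v v = 1 := by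
    refine ⟨(Real.sqrt (pair g v v))⁻¹, ?_⟩
    have h1 := Real.mul_self_sqrt hvv.le
    have h2 : Real.sqrt (pair g v v) ≠ 0 := (Real.sqrt_pos.2 hvv).ne'
    rw [← mul_inv, h1, inv_mul_cancel₀ hvv.ne']
  -- `n` is the null vector with `(ℓ, n) = 1` in the span of `ℓ`, `e` and `x`
  set s := pair g l x with hs_def
  set b := pair g x e with hb
  set t := pair g x x - b ^ 2 with ht
  let n : Fin 4 → ℝ := s⁻¹ • (x + ((-b) • e + (-(t / (2 * s))) • l))
  have hel : pair g e l = 0 := by rw [hcomm, hle]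
  have hxl : pair g x l = s := by rw [hcomm]
  have hex : pair g e x = b := by rw [hcomm]
  have hlv : pair g l v = 0 := by rw [hcomm, hvl]
  have hxv : pair g x v = 0 := by rw [hcomm, hvx]
  have hev : pair g e v = 0 := by rw [hcomm, hve]
  have hln : pair g l n = 1 := by
    simp only [n, pair_add_right g, pair_smul_right g, hl, hle, ← hs_def]
    field_simp
    ring
  have hne : pair g n e = 0 := by
    simp only [n, pair_add_left g, pair_smul_left g, he, hle, ← hb]
    ring
  have hnv : pair g n v = 0 := by
    simp only [n, pair_add_left g, pair_smul_left g, hlv, hxv, hev]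
    ring
  have hnn : pair g n n = 0 := by
    simp only [n, pair_add_left g, pair_smul_left g, pair_add_right g, pair_smul_right g, hl, hle,
      hel, hxl, hex, he, ← hb, ← hs_def]
    rw [ht]
    field_simp
    ring
  refine ⟨![l, n, e, r • v], fun i j => ?_, rfl, rfl⟩
  have hnl : pair g n l = 1 := by rw [hcomm, hln]
  have hen : pair g e n = 0 := by rw [hcomm, hne]
  have hvn : pair g v n = 0 := by rw [hcomm, hnv]
  have hrr : r * (r * pair g v v) = 1 := by rw [← hr]; ring
  fin_cases i <;> fin_cases j <;>
    simp [nullGram, pair_smul_left g, pair_smul_right g, *]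

namespace IsNullFrame

variable {g : Matrix (Fin 4) (Fin 4) ℝ} {E : Arr2 ℝ}

theorem mul_mul_transpose (hE : IsNullFrame g E) :
    Matrix.of E * g * (Matrix.of E).transpose = nullGram := by
  ext i j
  exact (mul_mul_transpose_apply g E i j).trans (hE i j)

theorem mul_eq_one (hE : IsNullFrame g E) :
    Matrix.of E * (g * (Matrix.of E).transpose * nullGram) = 1 := by
  have hK : nullGram * nullGram = 1 := by
    ext i j
    fin_cases i <;> fin_cases j <;> simp [nullGram, Matrix.mul_apply, Fin.sum_univ_four]
  rw [← Matrix.mul_assoc, ← Matrix.mul_assoc, hE.mul_mul_transpose, hK]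

theorem isUnit (hE : IsNullFrame g E) : IsUnit (Matrix.of E) :=
  Matrix.isUnit_iff_isUnit_det _ |>.2 (Matrix.isUnit_det_of_right_inverse hE.mul_eq_one)

/-- The frame is a basis, so that the inverse metric is `ℓ n + n ℓ + e₂ e₂ + e₃ e₃`. -/
theorem inv_eq (hE : IsNullFrame g E) : g⁻¹ = (Matrix.of E).transpose * nullGram * Matrix.of E := by
  refine Matrix.inv_eq_right_inv ?_
  have := mul_eq_one_comm.1 hE.mul_eq_one
  simpa only [Matrix.mul_assoc] using this

theorem mul_inv (hE : IsNullFrame g E) : g * g⁻¹ = 1 := by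
  rw [hE.inv_eq]
  have := mul_eq_one_comm.1 hE.mul_eq_one
  simpa only [Matrix.mul_assoc] using this

theorem inv_mul (hE : IsNullFrame g E) : g⁻¹ * g = 1 := mul_eq_one_comm.1 hE.mul_inv

theorem sum_mul_app (hE : IsNullFrame g E) (i j : Fin 4) :
    ∑ a, E i a * app g (E j) a = nullGram i j :=
  (pair_eq_sum_app g (E i) (E j)).symm.trans (hE i j)

theorem ext_covector (hE : IsNullFrame g E) {p q : Fin 4 → ℝ}
    (h : ∀ i, ∑ a, E i a * p a = ∑ a, E i a * q a) :
    p = q := by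
  have h' : (Matrix.of E).mulVec p = (Matrix.of E).mulVec q := funext h
  exact Matrix.mulVec_injective_of_isUnit hE.isUnit h'

theorem ext_arr2 (hE : IsNullFrame g E) {S T : Arr2 ℝ}
    (h : ∀ i j, pair S (E i) (E j) = pair T (E i) (E j)) :
    S = T := by
  have key : Matrix.of E * Matrix.of S * (Matrix.of E).transpose
      = Matrix.of E * Matrix.of T * (Matrix.of E).transpose := by
    ext i j
    rw [mul_mul_transpose_apply, mul_mul_transpose_apply, h]
  have hEt : IsUnit (Matrix.of E).transpose := (Matrix.isUnit_transpose (Matrix.of E)).2 hE.isUnit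
  exact hE.isUnit.mul_left_cancel (hEt.mul_right_cancel key)

/-- The scalar product of covectors in terms of frame components. -/
theorem sum_mul_raise (hE : IsNullFrame g E) (p q : Fin 4 → ℝ) :
    ∑ i, p i * raise g q i =
      (∑ a, E 0 a * p a) * (∑ a, E 1 a * q a) + (∑ a, E 1 a * p a) * (∑ a, E 0 a * q a)
        + (∑ a, E 2 a * p a) * (∑ a, E 2 a * q a) + (∑ a, E 3 a * p a) * (∑ a, E 3 a * q a) := by
  have h1 : ∑ i, p i * raise g q i
      = dotProduct ((Matrix.of E).mulVec p) (nullGram.mulVec ((Matrix.of E).mulVec q)) := by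
    have : raise g q = g⁻¹.mulVec q := rfl
    change dotProduct p (raise g q) = _
    rw [this, hE.inv_eq, ← Matrix.mulVec_mulVec, ← Matrix.mulVec_mulVec, Matrix.dotProduct_mulVec,
      Matrix.vecMul_transpose]
  rw [h1]
  have h2 : ∀ (r : Fin 4 → ℝ) i, (Matrix.of E).mulVec r i = ∑ a, E i a * r a := fun _ _ => rfl
  rw [dotProduct, Fin.sum_univ_four]
  simp only [Matrix.mulVec_eq_sum, nullGram]
  simp [Fin.sum_univ_four]
  ring

/-- The scalar product of 2-forms in terms of frame components. -/
theorem form2_eq (hE : IsNullFrame g E) {S T : Arr2 ℝ}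
    (hS : ∀ i j, S i j = -S j i) (hT : ∀ i j, T i j = -T j i) :
    form2 g S T =
      -(pair S (E 0) (E 1) * pair T (E 0) (E 1))
        + (pair S (E 0) (E 2) * pair T (E 1) (E 2) + pair S (E 1) (E 2) * pair T (E 0) (E 2))
        + (pair S (E 0) (E 3) * pair T (E 1) (E 3) + pair S (E 1) (E 3) * pair T (E 0) (E 3))
        + pair S (E 2) (E 3) * pair T (E 2) (E 3) := by
  have halt : ∀ {R : Arr2 ℝ}, (∀ i j, R i j = -R j i) → ∀ u v, pair R u v = -pair R v u := by
    intro R hR u v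
    simp only [pair, ← Finset.sum_neg_distrib]
    rw [Finset.sum_comm]
    exact Finset.sum_congr rfl fun i _ => Finset.sum_congr rfl fun j _ => by rw [hR j i]; ring
  have hsum : ∑ a, ∑ b, S a b * raise2 g T a b =
      Matrix.trace ((Matrix.of E * Matrix.of S * (Matrix.of E).transpose).transpose
        * (nullGram * (Matrix.of E * Matrix.of T * (Matrix.of E).transpose) * nullGram)) := by
    have h1 : Matrix.of (raise2 g T) = g⁻¹ * Matrix.of T * g⁻¹.transpose := by
      ext i j
      simp only [raise2, Matrix.of_apply, Matrix.mul_apply, Matrix.transpose_apply, Finset.sum_mul,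
        smul_eq_mul]
      rw [Finset.sum_comm]
      exact Finset.sum_congr rfl fun i _ => Finset.sum_congr rfl fun j _ => by ring
    have hKt : nullGram.transpose = nullGram := by
      ext i j; fin_cases i <;> fin_cases j <;> simp [nullGram]
    have h2 : ∑ a, ∑ b, S a b * raise2 g T a b
        = Matrix.trace ((Matrix.of S).transpose * Matrix.of (raise2 g T)) := by
      simp only [Matrix.trace, Matrix.diag, Matrix.mul_apply, Matrix.transpose_apply,
        Matrix.of_apply]
      exact Finset.sum_comm
    rw [h2, h1, hE.inv_eq]
    simp only [Matrix.transpose_mul, Matrix.transpose_transpose, hKt, Matrix.mul_assoc]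
    rw [Matrix.trace_mul_comm (Matrix.of E)]
    simp only [Matrix.mul_assoc]
  rw [form2, hsum]
  have hS' : ∀ i j, (Matrix.of E * Matrix.of S * (Matrix.of E).transpose) i j
      = pair S (E i) (E j) :=
    mul_mul_transpose_apply S E
  have hT' : ∀ i j, (Matrix.of E * Matrix.of T * (Matrix.of E).transpose) i j
      = pair T (E i) (E j) :=
    mul_mul_transpose_apply T E
  generalize Matrix.of E * Matrix.of S * (Matrix.of E).transpose = S' at hS'
  generalize Matrix.of E * Matrix.of T * (Matrix.of E).transpose = T' at hT'
  simp only [Matrix.trace, Matrix.diag, Matrix.mul_apply, Matrix.transpose_apply, hS', hT',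
    Fin.sum_univ_four, nullGram]
  simp
  have d : ∀ {R : Arr2 ℝ}, (∀ i j, R i j = -R j i) → ∀ u, pair R u u = 0 := by
    intro R hR u; linarith [halt hR u u]
  rw [d hS, d hS, d hT, d hT, d hS, d hS, d hT, d hT, halt hS (E 1) (E 0), halt hS (E 2) (E 0),
    halt hS (E 3) (E 0), halt hS (E 2) (E 1), halt hS (E 3) (E 1), halt hS (E 3) (E 2),
    halt hT (E 1) (E 0), halt hT (E 2) (E 0), halt hT (E 3) (E 0), halt hT (E 2) (E 1),
    halt hT (E 3) (E 1), halt hT (E 3) (E 2)]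
  ring

end IsNullFrame

/-! ### Null 2-forms and their duals in an adapted frame -/

/-- The components of a nonzero alternating 4-form. -/
def IsVolume (η : Arr4 ℝ) : Prop :=
  ∃ f : (Fin 4 → ℝ) [⋀^Fin 4]→ₗ[ℝ] ℝ, f ≠ 0 ∧
    ∀ i j k m, η i j k m = f ![Pi.single i 1, Pi.single j 1, Pi.single k 1, Pi.single m 1]

theorem alternatingMap_apply_eq_sum (f : (Fin 4 → ℝ) [⋀^Fin 4]→ₗ[ℝ] ℝ) (u v s t : Fin 4 → ℝ) :
    f ![u, v, s, t] = ∑ i, ∑ j, ∑ k, ∑ m, u i * v j * s k * t m *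
      f ![Pi.single i 1, Pi.single j 1, Pi.single k 1, Pi.single m 1] := by
  have key : ∀ {X : Type} [AddCommGroup X] [Module ℝ X] (φ : (Fin 4 → ℝ) →ₗ[ℝ] X) (w : Fin 4 → ℝ),
      φ w = ∑ i, w i • φ (Pi.single i 1) := by
    intro X _ _ φ w
    conv_lhs => rw [← Finset.univ_sum_single w]
    rw [map_sum]
    refine Finset.sum_congr rfl fun i _ => ?_
    rw [← map_smul, ← Pi.single_smul, smul_eq_mul, mul_one]
  have hc : ∀ u v s t : Fin 4 → ℝ, f ![u, v, s, t] =
      (((f.toMultilinearMap.curryLeft u).curryLeft v).curryLeft s).curryLeft t ![] :=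
    fun _ _ _ _ => rfl
  simp only [hc]
  rw [key f.toMultilinearMap.curryLeft u]
  simp only [MultilinearMap.curryLeft_apply, sum_apply, smul_apply]
  refine Finset.sum_congr rfl fun i _ => ?_
  have h2 := key (f.toMultilinearMap.curryLeft (Pi.single i 1)).curryLeft v
  have h2' := congrArg (fun F => F (Fin.cons s (Fin.cons t ![]))) h2
  simp only [MultilinearMap.curryLeft_apply, sum_apply,
    smul_apply] at h2'
  rw [h2', Finset.smul_sum]
  refine Finset.sum_congr rfl fun j _ => ?_
  have h3 := key ((f.toMultilinearMap.curryLeft (Pi.single i 1)).curryLeft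
    (Pi.single j 1)).curryLeft s
  have h3' := congrArg (fun F => F (Fin.cons t ![])) h3
  simp only [MultilinearMap.curryLeft_apply, sum_apply,
    smul_apply] at h3'
  rw [h3', Finset.smul_sum, Finset.smul_sum]
  refine Finset.sum_congr rfl fun k _ => ?_
  have h4 := key (((f.toMultilinearMap.curryLeft (Pi.single i 1)).curryLeft
    (Pi.single j 1)).curryLeft (Pi.single k 1)).curryLeft t
  have h4' := congrArg (fun F => F ![]) h4
  simp only [MultilinearMap.curryLeft_apply, sum_apply,
    smul_apply] at h4'
  rw [h4']
  simp only [Finset.smul_sum]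
  refine Finset.sum_congr rfl fun m _ => ?_
  simp only [smul_eq_mul, ← mul_assoc]

section Hodge

variable {g : Matrix (Fin 4) (Fin 4) ℝ} {η : Arr4 ℝ} {L : Arr2 ℝ} {l e : Fin 4 → ℝ}

theorem raise_app (hg : g⁻¹ * g = 1) (v : Fin 4 → ℝ) : raise g (app g v) = v := by
  have : raise g (app g v) = g⁻¹.mulVec (g.mulVec v) := rfl
  rw [this, Matrix.mulVec_mulVec, hg, Matrix.one_mulVec]

/-- The dual of `ℓ ∧ e` is obtained by inserting `ℓ` and `e` into the volume element. -/
theorem pair_hodge_wedge (hg : g⁻¹ * g = 1) {f : (Fin 4 → ℝ) [⋀^Fin 4]→ₗ[ℝ] ℝ}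
    (hf : ∀ i j k m, η i j k m = f ![Pi.single i 1, Pi.single j 1, Pi.single k 1, Pi.single m 1])
    (hL : ∀ i j, L i j = app g l i * app g e j - app g l j * app g e i) (u v : Fin 4 → ℝ) :
    pair (hodge g η L) u v = f ![u, v, l, e] := by
  have hr : ∀ c d, raise2 g L c d = l c * e d - e c * l d := by
    intro c d
    have h1 : raise2 g L c d = raise g (app g l) c * raise g (app g e) d
        - raise g (app g e) c * raise g (app g l) d := by
      simp only [raise2, raise, hL, smul_eq_mul, Finset.sum_mul_sum, ← Finset.sum_sub_distrib]
      exact Finset.sum_congr rfl fun i _ => Finset.sum_congr rfl fun j _ => by ring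
    rw [h1, raise_app hg, raise_app hg]
  have hswap : f ![u, v, e, l] = -f ![u, v, l, e] := by
    have := f.map_swap (v := ![u, v, l, e]) (i := 2) (j := 3) (by decide)
    rw [← this]
    congr 1
    ext i
    fin_cases i <;> rfl
  have h2 : pair (hodge g η L) u v = (1 / 2) * (f ![u, v, l, e] - f ![u, v, e, l]) := by
    rw [alternatingMap_apply_eq_sum, alternatingMap_apply_eq_sum f u v e l]
    simp only [pair, hodge, hr, ← hf, ← Finset.sum_sub_distrib, Finset.mul_sum, Finset.sum_mul]
    exact Finset.sum_congr rfl fun i _ => Finset.sum_congr rfl fun j _ =>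
      Finset.sum_congr rfl fun k _ => Finset.sum_congr rfl fun m _ => by ring
  rw [h2, hswap]
  ring

end Hodge

/-- A null frame `E = (ℓ, n, e₂, e₃)` in which `L = ℓ ∧ e₂` and `H = -ε ℓ ∧ e₃`. For `H = *L`, the
factor `ε` is the value of the volume element on the frame (up to order); only `ε ≠ 0` matters. -/
structure IsAdapted (g : Matrix (Fin 4) (Fin 4) ℝ) (L H : Arr2 ℝ) (l : Fin 4 → ℝ)
    (E : Arr2 ℝ) (ε : ℝ) : Prop where
  symm : ∀ i j, g i j = g j i
  frame : IsNullFrame g E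
  zero_eq : E 0 = l
  eps_ne : ε ≠ 0
  form : ∀ i j, L i j = app g l i * app g (E 2) j - app g l j * app g (E 2) i
  dual : ∀ i j, H i j = -ε * (app g l i * app g (E 3) j - app g l j * app g (E 3) i)

theorem pair_of_wedge {T : Arr2 ℝ} {p q : Fin 4 → ℝ} {c : ℝ}
    (hT : ∀ i j, T i j = c * (p i * q j - p j * q i)) (u v : Fin 4 → ℝ) :
    pair T u v = c * ((∑ i, u i * p i) * (∑ i, v i * q i)
      - (∑ i, v i * p i) * (∑ i, u i * q i)) := by
  simp only [pair, hT, Finset.sum_mul_sum]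
  rw [Finset.sum_comm (f := fun i j => v i * p i * (u j * q j)), ← Finset.sum_sub_distrib,
    Finset.mul_sum]
  refine Finset.sum_congr rfl fun i _ => ?_
  rw [← Finset.sum_sub_distrib, Finset.mul_sum]
  exact Finset.sum_congr rfl fun j _ => by ring

theorem exists_isAdapted {g : Matrix (Fin 4) (Fin 4) ℝ} (hg : IsLorentzian g) {η : Arr4 ℝ}
    (hη : IsVolume η) {L : Arr2 ℝ} {l : Fin 4 → ℝ} (h : IsFundamentalVector g η L l) :
    ∃ E ε, IsAdapted g L (hodge g η L) l E ε := by
  obtain ⟨e, he, hle, hL⟩ := h.normalised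
  obtain ⟨E, hE, hE0, hE2⟩ := exists_nullFrame hg h.ne_zero h.null he hle
  obtain ⟨f, hf0, hf⟩ := hη
  subst hE0 hE2
  refine ⟨E, f ![E 3, E 1, E 0, E 2], hg.symm, hE, rfl, ?_, hL, ?_⟩
  · intro h0
    -- an alternating form that vanishes on a basis is zero
    have hinj : Function.Injective (![3, 1, 0, 2] : Fin 4 → Fin 4) := by decide
    have hli : LinearIndependent ℝ (E ∘ ![3, 1, 0, 2]) :=
      (Matrix.linearIndependent_rows_of_isUnit hE.isUnit).comp _ hinj
    let b := basisOfLinearIndependentOfCardEqFinrank hli (by simp)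
    have hb : (b : Fin 4 → Fin 4 → ℝ) = ![E 3, E 1, E 0, E 2] := by
      rw [coe_basisOfLinearIndependentOfCardEqFinrank]
      ext i j
      fin_cases i <;> rfl
    exact hf0 ((f.map_basis_eq_zero_iff b).1 (hb ▸ h0))
  · have key : hodge g η L = fun i j => -f ![E 3, E 1, E 0, E 2] *
        (app g (E 0) i * app g (E 3) j - app g (E 0) j * app g (E 3) i) := by
      refine hE.ext_arr2 fun i j => ?_
      rw [pair_hodge_wedge hE.inv_mul hf hL, pair_of_wedge (fun _ _ => rfl)]
      simp only [hE.sum_mul_app]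
      have hz : ∀ v : Fin 4 → Fin 4 → ℝ, ∀ i j, i ≠ j → v i = v j → f v = 0 :=
        fun v i j hij hv => f.map_eq_zero_of_eq v hv hij
      have hswap : f ![E 1, E 3, E 0, E 2] = -f ![E 3, E 1, E 0, E 2] := by
        have := f.map_swap (v := ![E 3, E 1, E 0, E 2]) (i := 0) (j := 1) (by decide)
        rw [← this]
        congr 1
        ext i
        fin_cases i <;> rfl
      fin_cases i <;> fin_cases j <;> simp [nullGram, hswap]
      all_goals first
        | exact hz _ 0 1 (by decide) rfl
        | exact hz _ 0 2 (by decide) rfl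
        | exact hz _ 1 2 (by decide) rfl
        | exact hz _ 0 3 (by decide) rfl
        | exact hz _ 1 3 (by decide) rfl
    intro i j
    rw [key]

/-- `T` and `B` are first-order variations of a 2-form `L` and a vector `ℓ` that keep the relations
`L(ℓ) = 0` and `ℓ ∧ L = 0`. -/
structure IsNullVariation (g : Matrix (Fin 4) (Fin 4) ℝ) (L T : Arr2 ℝ) (l B : Fin 4 → ℝ) :
    Prop where
  antisymm : ∀ i j, T i j = -T j i
  kernel : ∀ i, ∑ j, (T i j * l j + L i j * B j) = 0
  wedge : ∀ i j k, app g B i * L j k + app g l i * T j k + (app g B j * L k i + app g l j * T k i)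
    + (app g B k * L i j + app g l k * T i j) = 0

namespace IsNullVariation

variable {g : Matrix (Fin 4) (Fin 4) ℝ} {L T : Arr2 ℝ} {l B : Fin 4 → ℝ}

theorem pair_kernel (h : IsNullVariation g L T l B) (u : Fin 4 → ℝ) :
    pair T u l = -pair L u B := by
  have : ∑ i, u i * ∑ j, (T i j * l j + L i j * B j) = 0 := by simp [h.kernel]
  rw [eq_neg_iff_add_eq_zero, ← this, pair, pair, ← Finset.sum_add_distrib]
  refine Finset.sum_congr rfl fun i _ => ?_
  rw [← Finset.sum_add_distrib, Finset.mul_sum]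
  exact Finset.sum_congr rfl fun j _ => by ring

theorem pair_wedge (h : IsNullVariation g L T l B) (u v w : Fin 4 → ℝ) :
    pair g u B * pair L v w + pair g u l * pair T v w
      + (pair g v B * pair L w u + pair g v l * pair T w u)
      + (pair g w B * pair L u v + pair g w l * pair T u v) = 0 := by
  have key : ∀ (p : Fin 4 → ℝ) (S : Arr2 ℝ) (u v w : Fin 4 → ℝ), (∑ i, u i * p i) * pair S v w
      = ∑ i, ∑ j, ∑ k, u i * v j * w k * (p i * S j k) := by
    intro p S u v w
    rw [pair, Finset.sum_mul]
    simp only [Finset.mul_sum]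
    exact Finset.sum_congr rfl fun i _ => Finset.sum_congr rfl fun j _ =>
      Finset.sum_congr rfl fun k _ => by ring
  have hsum : ∑ i, ∑ j, ∑ k, u i * v j * w k * (app g B i * L j k + app g l i * T j k
      + (app g B j * L k i + app g l j * T k i)
      + (app g B k * L i j + app g l k * T i j)) = 0 := by simp [h.wedge]
  have c1 : ∀ f : Fin 4 → Fin 4 → Fin 4 → ℝ,
      ∑ i, ∑ j, ∑ k, f i j k = ∑ k, ∑ i, ∑ j, f i j k := by
    intro f
    rw [Finset.sum_comm' (t' := Finset.univ) (s' := fun _ => Finset.univ) (by simp)]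
    rw [Finset.sum_congr rfl fun j _ => Finset.sum_comm, Finset.sum_comm]
    exact Finset.sum_congr rfl fun k _ => Finset.sum_comm
  rw [pair_eq_sum_app g u, pair_eq_sum_app g u, pair_eq_sum_app g v, pair_eq_sum_app g v,
    pair_eq_sum_app g w, pair_eq_sum_app g w]
  simp only [key]
  rw [c1 fun i j k => v i * w j * u k * (app g B i * L j k),
    c1 fun i j k => v i * w j * u k * (app g l i * T j k),
    ← c1 fun j k i => w i * u j * v k * (app g B i * L j k),
    ← c1 fun j k i => w i * u j * v k * (app g l i * T j k)]
  rw [← hsum]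
  simp only [← Finset.sum_add_distrib]
  exact Finset.sum_congr rfl fun i _ => Finset.sum_congr rfl fun j _ =>
      Finset.sum_congr rfl fun k _ => by ring

end IsNullVariation

namespace IsAdapted

variable {g : Matrix (Fin 4) (Fin 4) ℝ} {L H T S : Arr2 ℝ} {l B : Fin 4 → ℝ}
  {E : Arr2 ℝ} {ε : ℝ}

theorem pair_form (hA : IsAdapted g L H l E ε) (u v : Fin 4 → ℝ) :
    pair L u v = pair g u l * pair g v (E 2) - pair g v l * pair g u (E 2) := by
  rw [pair_of_wedge (c := 1) (fun i j => by rw [hA.form, one_mul])]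
  simp only [one_mul]
  rw [pair_eq_sum_app g, pair_eq_sum_app g, pair_eq_sum_app g, pair_eq_sum_app g]

theorem pair_dual (hA : IsAdapted g L H l E ε) (u v : Fin 4 → ℝ) :
    pair H u v = -ε * (pair g u l * pair g v (E 3) - pair g v l * pair g u (E 3)) := by
  rw [pair_of_wedge hA.dual]
  rw [pair_eq_sum_app g, pair_eq_sum_app g, pair_eq_sum_app g, pair_eq_sum_app g]

/-- The scalar products of variations of `L` and `H` over `B`, in terms of `(B, e₂)` and
`(B, e₃)`. -/
theorem form2_variation (hA : IsAdapted g L H l E ε) (hB : pair g B l = 0)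
    (hT : IsNullVariation g L T l B) (hS : IsNullVariation g H S l B) :
    form2 g T T = pair g B (E 3) ^ 2 - pair g B (E 2) ^ 2 ∧
    form2 g S S = -ε ^ 2 * (pair g B (E 3) ^ 2 - pair g B (E 2) ^ 2) ∧
    form2 g T S = 2 * ε * (pair g B (E 2) * pair g B (E 3)) ∧
    form2 g S T = 2 * ε * (pair g B (E 2) * pair g B (E 3)) := by
  have hE := hA.frame
  have hcomm := pair_comm hA.symm
  have hl := hA.zero_eq
  subst hl
  have alt : ∀ {R : Arr2 ℝ}, (∀ i j, R i j = -R j i) → ∀ u v, pair R u v = -pair R v u := by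
    intro R hR u v
    simp only [pair, ← Finset.sum_neg_distrib]
    rw [Finset.sum_comm]
    exact Finset.sum_congr rfl fun i _ => Finset.sum_congr rfl fun j _ => by rw [hR j i]; ring
  have hE' : ∀ i j, pair g (E i) (E j) = nullGram i j := hE
  have hT0 : ∀ i, pair T (E 0) (E i) = pair L (E i) B := fun i => by
    rw [alt hT.antisymm, hT.pair_kernel, neg_neg]
  have hS0 : ∀ i, pair S (E 0) (E i) = pair H (E i) B := fun i => by
    rw [alt hS.antisymm, hS.pair_kernel, neg_neg]
  have hT23 := hT.pair_wedge (E 1) (E 2) (E 3)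
  have hS23 := hS.pair_wedge (E 1) (E 2) (E 3)
  rw [hcomm _ B, hcomm _ B, hcomm _ B] at hT23 hS23
  simp only [hA.pair_form, hE', nullGram] at hT23
  simp only [hA.pair_dual, hE', nullGram] at hS23
  simp at hT23 hS23
  have hT23' : pair T (E 2) (E 3) = -pair g B (E 3) := by linarith
  have hS23' : pair S (E 2) (E 3) = -ε * pair g B (E 2) := by linarith
  rw [hE.form2_eq hT.antisymm hT.antisymm, hE.form2_eq hS.antisymm hS.antisymm,
    hE.form2_eq hT.antisymm hS.antisymm, hE.form2_eq hS.antisymm hT.antisymm]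
  simp only [hT0, hS0, hT23', hS23', hA.pair_form, hA.pair_dual, hE', hB, nullGram]
  simp
  refine ⟨?_, ?_, ?_, ?_⟩ <;> ring

end IsAdapted

theorem form2C_bivector (g : Matrix (Fin 4) (Fin 4) ℝ) (T S : Arr2 ℝ) :
    form2C g (fun i j => ((T i j : ℂ) - Complex.I * (S i j : ℂ)) / ((Real.sqrt 2 : ℝ) : ℂ))
        (fun i j => ((T i j : ℂ) - Complex.I * (S i j : ℂ)) / ((Real.sqrt 2 : ℝ) : ℂ))
      = (((form2 g T T - form2 g S S) / 2 : ℝ) : ℂ)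
        - Complex.I * (((form2 g T S + form2 g S T) / 2 : ℝ) : ℂ) := by
  have h2 : ((Real.sqrt 2 : ℝ) : ℂ) * ((Real.sqrt 2 : ℝ) : ℂ) = 2 := by
    rw [← Complex.ofReal_mul, Real.mul_self_sqrt (by norm_num)]
    norm_num
  have hne : ((Real.sqrt 2 : ℝ) : ℂ) ≠ 0 := by
    intro h
    rw [h] at h2
    norm_num at h2
  have hr : ∀ a b, raise2 g
      (fun i j => ((T i j : ℂ) - Complex.I * (S i j : ℂ)) / ((Real.sqrt 2 : ℝ) : ℂ)) a b
        = (((raise2 g T a b : ℝ) : ℂ) - Complex.I * ((raise2 g S a b : ℝ) : ℂ))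
          / ((Real.sqrt 2 : ℝ) : ℂ) := by
    intro a b
    simp only [raise2, Complex.real_smul, smul_eq_mul, Complex.ofReal_sum, Complex.ofReal_mul,
      Finset.mul_sum, ← Finset.sum_sub_distrib, Finset.sum_div]
    exact Finset.sum_congr rfl fun i _ => Finset.sum_congr rfl fun j _ => by ring
  have hI := Complex.I_mul_I
  simp only [form2C, hr, form2]
  push_cast
  simp only [Finset.mul_sum, ← Finset.sum_sub_distrib, Finset.sum_div, ← Finset.sum_add_distrib]
  refine Finset.sum_congr rfl fun i _ => Finset.sum_congr rfl fun j _ => ?_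
  field_simp
  rw [pow_two ((Real.sqrt 2 : ℝ) : ℂ), h2]
  linear_combination (2 * (S i j : ℂ) * ((raise2 g S i j : ℝ) : ℂ)) * hI

/-- If the variation of the bivector `ℒ` is null, then the variation `B` of `ℓ` is orthogonal to
`e₂` and `e₃`: the product of the former with itself is `½ (1 + ε²) (b₃² - b₂²) - 2 i ε b₂ b₃` with
`bᵢ = (B, eᵢ)`. -/
theorem IsAdapted.components_eq_zero {g : Matrix (Fin 4) (Fin 4) ℝ} {L H T S : Arr2 ℝ}
    {l B : Fin 4 → ℝ} {E : Arr2 ℝ} {ε : ℝ} (hA : IsAdapted g L H l E ε) (hB : pair g B l = 0)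
    (hT : IsNullVariation g L T l B) (hS : IsNullVariation g H S l B)
    (h0 : form2C g (fun i j => ((T i j : ℂ) - Complex.I * (S i j : ℂ)) / ((Real.sqrt 2 : ℝ) : ℂ))
        (fun i j => ((T i j : ℂ) - Complex.I * (S i j : ℂ)) / ((Real.sqrt 2 : ℝ) : ℂ)) = 0) :
    pair g B (E 2) = 0 ∧ pair g B (E 3) = 0 := by
  obtain ⟨hTT, hSS, hTS, hST⟩ := hA.form2_variation hB hT hS
  rw [form2C_bivector, hTT, hSS, hTS, hST] at h0
  have hre := congrArg Complex.re h0
  have him := congrArg Complex.im h0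
  simp only [Complex.sub_re, Complex.sub_im, Complex.mul_re, Complex.mul_im, Complex.I_re,
    Complex.I_im, Complex.ofReal_re, Complex.ofReal_im, Complex.zero_re, Complex.zero_im] at hre him
  set p := pair g B (E 2)
  set q := pair g B (E 3)
  have h1 : p * q = 0 := by
    have : ε * (p * q) = 0 := by linarith
    exact (mul_eq_zero.1 this).resolve_left hA.eps_ne
  have h2 : q ^ 2 - p ^ 2 = 0 := by
    have : (1 + ε ^ 2) * (q ^ 2 - p ^ 2) = 0 := by linarith
    exact (mul_eq_zero.1 this).resolve_left (by positivity)
  rcases mul_eq_zero.1 h1 with h | h <;> rw [h] at h2 ⊢ <;> simpa using h2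

/-! ### Partial derivatives -/

section PartialDerivatives

open Filter Topology

variable {y : E4} {u v : E4 → ℝ}

theorem pd_congr {k : Fin 4} (h : u =ᶠ[𝓝 y] v) : pd k u y = pd k v y := by
  rw [pd, pd, h.fderiv_eq]

theorem pd_add (k : Fin 4) (hu : DifferentiableAt ℝ u y) (hv : DifferentiableAt ℝ v y) :
    pd k (fun z => u z + v z) y = pd k u y + pd k v y := by
  rw [pd, fderiv_fun_add hu hv]
  rfl

theorem pd_mul (k : Fin 4) (hu : DifferentiableAt ℝ u y) (hv : DifferentiableAt ℝ v y) :
    pd k (fun z => u z * v z) y = pd k u y * v y + u y * pd k v y := by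
  rw [pd, fderiv_fun_mul hu hv]
  simp only [add_apply, smul_apply, smul_eq_mul, pd]
  ring

theorem pd_neg (k : Fin 4) : pd k (fun z => -u z) y = -pd k u y := by
  rw [pd, fderiv_fun_neg]
  rfl

theorem pd_sum (k : Fin 4) {w : Fin 4 → E4 → ℝ} (hw : ∀ i, DifferentiableAt ℝ (w i) y) :
    pd k (fun z => ∑ i, w i z) y = ∑ i, pd k (w i) y := by
  rw [pd, fderiv_fun_sum fun i _ => hw i]
  simp [pd]

theorem pd_eq_zero {k : Fin 4} (h : ∀ᶠ z in 𝓝 y, u z = 0) : pd k u y = 0 := by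
  have h' : u =ᶠ[𝓝 y] fun _ => 0 := h
  rw [pd_congr h', pd]
  simp

theorem pd_ofReal_sub_I_mul (k : Fin 4) (hu : DifferentiableAt ℝ u y) (hv : DifferentiableAt ℝ v y)
    (c : ℂ) : pd k (fun z => ((u z : ℂ) - Complex.I * (v z : ℂ)) / c) y
      = (((pd k u y : ℝ) : ℂ) - Complex.I * ((pd k v y : ℝ) : ℂ)) / c := by
  have h1 : HasFDerivAt (fun z => (u z : ℂ)) (Complex.ofRealCLM.comp (fderiv ℝ u y)) y :=
    Complex.ofRealCLM.hasFDerivAt.comp y hu.hasFDerivAt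
  have h2 : HasFDerivAt (fun z => (v z : ℂ)) (Complex.ofRealCLM.comp (fderiv ℝ v y)) y :=
    Complex.ofRealCLM.hasFDerivAt.comp y hv.hasFDerivAt
  have h3 := (h1.sub (h2.const_mul Complex.I)).mul_const c⁻¹
  have h4 : HasFDerivAt (fun z => ((u z : ℂ) - Complex.I * (v z : ℂ)) / c) _ y := h3
  rw [pd, h4.fderiv]
  simp [pd, div_eq_mul_inv]
  ring

theorem contDiffAt_pd (k : Fin 4) (hu : ContDiffAt ℝ ∞ u y) : ContDiffAt ℝ ∞ (pd k u) y :=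
  (hu.fderiv_right (m := ∞) (by simp)).clm_apply contDiffAt_const

theorem pd_comm (c d : Fin 4) (hu : ContDiffAt ℝ ∞ u y) :
    pd c (pd d u) y = pd d (pd c u) y := by
  have hd : DifferentiableAt ℝ (fderiv ℝ u) y :=
    (hu.fderiv_right (m := ∞) (by simp)).differentiableAt (by simp)
  have key : ∀ c d, pd c (pd d u) y
      = fderiv ℝ (fderiv ℝ u) y (EuclideanSpace.single c 1) (EuclideanSpace.single d 1) := by
    intro c d
    have : pd d u = fun z => fderiv ℝ u z (EuclideanSpace.single d 1) := rfl
    rw [this, pd, fderiv_clm_apply hd (differentiableAt_const _)]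
    simp
  rw [key, key]
  exact (hu.isSymmSndFDerivAt (by simp; exact WithTop.coe_le_coe.2 (le_top : (2 : ℕ∞) ≤ ⊤))) _ _

theorem contDiffAt_det {A : E4 → Matrix (Fin 4) (Fin 4) ℝ}
    (hA : ∀ i j, ContDiffAt ℝ ∞ (fun z => A z i j) y) : ContDiffAt ℝ ∞ (fun z => (A z).det) y := by
  simp only [Matrix.det_apply']
  exact ContDiffAt.sum fun σ _ => contDiffAt_const.mul (contDiffAt_prod fun i _ => hA _ _)

theorem contDiffAt_inv {A : E4 → Matrix (Fin 4) (Fin 4) ℝ}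
    (hA : ∀ i j, ContDiffAt ℝ ∞ (fun z => A z i j) y) (h0 : (A y).det ≠ 0) (i j : Fin 4) :
    ContDiffAt ℝ ∞ (fun z => (A z)⁻¹ i j) y := by
  simp only [Matrix.inv_def, Ring.inverse_eq_inv', Matrix.smul_apply, smul_eq_mul,
    Matrix.adjugate_apply]
  refine ((contDiffAt_det hA).inv h0).mul (contDiffAt_det fun p q => ?_)
  by_cases hp : p = j
  · subst hp
    simpa using contDiffAt_const
  · simpa [Matrix.updateRow_ne hp] using hA p q

end PartialDerivatives

/-! ### The Levi-Civita connection in coordinates -/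

/-- The covariant derivative `∇ₖ ℓᵃ` of a vector field. -/
def nablaVec (g : E4 → Matrix (Fin 4) (Fin 4) ℝ) (l : E4 → Fin 4 → ℝ) (y : E4) : Arr2 ℝ :=
  fun k a => pd k (fun z => l z a) y + ∑ m, christoffel g a k m y * l y m

section Connection

open Filter Topology

variable {g : E4 → Matrix (Fin 4) (Fin 4) ℝ} {l : E4 → Fin 4 → ℝ} {L : E4 → Arr2 ℝ} {y : E4}

theorem christoffel_symm (hs : ∀ z i j, g z i j = g z j i) (k i j : Fin 4) :
    christoffel g k i j = christoffel g k j i := by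
  funext z
  have h : (fun z => g z i j) = fun z => g z j i := funext fun z => hs z i j
  simp only [christoffel, h]
  congr 1
  exact Finset.sum_congr rfl fun m _ => by ring

theorem contDiffAt_christoffel (hg : ∀ i j, ContDiffAt ℝ ∞ (fun z => g z i j) y)
    (h0 : (g y).det ≠ 0) (k i j : Fin 4) : ContDiffAt ℝ ∞ (christoffel g k i j) y := by
  unfold christoffel
  refine contDiffAt_const.mul (ContDiffAt.sum fun m _ => (contDiffAt_inv hg h0 k m).mul ?_)
  exact ((contDiffAt_pd i (hg j m)).add (contDiffAt_pd j (hg i m))).sub (contDiffAt_pd m (hg i j))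

theorem contDiffAt_nablaVec (hg : ∀ i j, ContDiffAt ℝ ∞ (fun z => g z i j) y)
    (h0 : (g y).det ≠ 0) (hl : ∀ i, ContDiffAt ℝ ∞ (fun z => l z i) y) (k a : Fin 4) :
    ContDiffAt ℝ ∞ (fun z => nablaVec g l z k a) y :=
  (contDiffAt_pd k (hl a)).add
    (ContDiffAt.sum fun m _ => (contDiffAt_christoffel hg h0 a k m).mul (hl m))

/-- The connection is metric: `∂ₖ gᵢⱼ = Γᵐₖᵢ gₘⱼ + Γᵐₖⱼ gᵢₘ`. -/
theorem pd_metric (hs : ∀ z i j, g z i j = g z j i) (hinv : g y * (g y)⁻¹ = 1) (k i j : Fin 4) :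
    pd k (fun z => g z i j) y
      = ∑ m, (christoffel g m k i y * g y m j + christoffel g m k j y * g y i m) := by
  have hsf : ∀ i j, (fun z => g z i j) = fun z => g z j i := fun i j => funext fun z => hs z i j
  have lower : ∀ i j, ∑ m, g y j m * christoffel g m k i y = (1 / 2) *
      (pd k (fun z => g z i j) y + pd i (fun z => g z k j) y - pd j (fun z => g z k i) y) := by
    intro i j
    set D : Fin 4 → ℝ := fun m =>
      pd k (fun z => g z i m) y + pd i (fun z => g z k m) y - pd m (fun z => g z k i) y with hD
    have h1 : ∑ m, g y j m * christoffel g m k i y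
        = (1 / 2) * (g y).mulVec ((g y)⁻¹.mulVec D) j := by
      simp only [Matrix.mulVec, dotProduct, christoffel, hD, Finset.mul_sum]
      exact Finset.sum_congr rfl fun m _ => Finset.sum_congr rfl fun p _ => by ring
    rw [h1, Matrix.mulVec_mulVec, hinv, Matrix.one_mulVec]
  have h1 := lower i j
  have h2 := lower j i
  rw [hsf j i, hsf k j, hsf k i] at h2
  rw [hsf k j, hsf k i] at h1
  rw [Finset.sum_add_distrib]
  have e1 : ∑ m, christoffel g m k i y * g y m j = ∑ m, g y j m * christoffel g m k i y :=
    Finset.sum_congr rfl fun m _ => by rw [hs y m j]; ring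
  have e2 : ∑ m, christoffel g m k j y * g y i m = ∑ m, g y i m * christoffel g m k j y :=
    Finset.sum_congr rfl fun m _ => by ring
  rw [e1, e2, h1, h2]
  ring

/-- `∇ₖ ℓᵢ = gᵢₐ ∇ₖ ℓᵃ`. -/
theorem pd_app (hs : ∀ z i j, g z i j = g z j i) (hinv : g y * (g y)⁻¹ = 1)
    (hg : ∀ i j, DifferentiableAt ℝ (fun z => g z i j) y)
    (hl : ∀ i, DifferentiableAt ℝ (fun z => l z i) y) (k i : Fin 4) :
    pd k (fun z => app (g z) (l z) i) y
      = app (g y) (nablaVec g l y k) i + ∑ m, christoffel g m k i y * app (g y) (l y) m := by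
  simp only [app]
  rw [pd_sum k fun j => (hg i j).fun_mul (hl j)]
  simp only [pd_mul k (hg i _) (hl _), pd_metric hs hinv, nablaVec]
  simp only [Fin.sum_univ_four]
  ring

theorem differentiableAt_app (hg : ∀ i j, DifferentiableAt ℝ (fun z => g z i j) y)
    (hl : ∀ i, DifferentiableAt ℝ (fun z => l z i) y) (i : Fin 4) :
    DifferentiableAt ℝ (fun z => app (g z) (l z) i) y := by
  simp only [app]
  exact DifferentiableAt.fun_sum fun j _ => (hg i j).fun_mul (hl j)

theorem pair_nablaVec_eq_zero (hs : ∀ z i j, g z i j = g z j i) (hinv : g y * (g y)⁻¹ = 1)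
    (hg : ∀ i j, DifferentiableAt ℝ (fun z => g z i j) y)
    (hl : ∀ i, DifferentiableAt ℝ (fun z => l z i) y)
    (hnull : ∀ᶠ z in 𝓝 y, pair (g z) (l z) (l z) = 0) (k : Fin 4) :
    pair (g y) (nablaVec g l y k) (l y) = 0 := by
  have h0 : pd k (fun z => ∑ i, l z i * app (g z) (l z) i) y = 0 :=
    pd_eq_zero (hnull.mono fun z hz => (pair_eq_sum_app (g z) _ _).symm.trans hz)
  have hd := differentiableAt_app hg hl
  rw [pd_sum k fun i => (hl i).fun_mul (hd i)] at h0
  simp only [pd_mul k (hl _) (hd _), pd_app hs hinv hg hl] at h0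
  have hc := pair_comm (hs y) (nablaVec g l y k) (l y)
  have hpd : ∀ i, pd k (fun z => l z i) y
      = nablaVec g l y k i - ∑ m, christoffel g i k m y * l y m := fun i => by
    simp only [nablaVec]; ring
  simp only [hpd] at h0
  have e1 := pair_eq_sum_app (g y) (nablaVec g l y k) (l y)
  have e2 := pair_eq_sum_app (g y) (l y) (nablaVec g l y k)
  rw [hc] at e1
  rw [hc]
  simp only [Fin.sum_univ_four] at h0 e1 e2
  linarith

/-- Differentiating the relations `L(ℓ) = 0` and `ℓ ∧ L = 0`. -/
theorem isNullVariation_covDeriv (hs : ∀ z i j, g z i j = g z j i) (hinv : g y * (g y)⁻¹ = 1)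
    (hg : ∀ i j, DifferentiableAt ℝ (fun z => g z i j) y)
    (hl : ∀ i, DifferentiableAt ℝ (fun z => l z i) y)
    (hL : ∀ i j, DifferentiableAt ℝ (fun z => L z i j) y)
    (hanti : ∀ᶠ z in 𝓝 y, ∀ i j, L z i j = -L z j i)
    (hker : ∀ᶠ z in 𝓝 y, ∀ i, ∑ j, L z i j * l z j = 0)
    (hwedge : ∀ᶠ z in 𝓝 y, ∀ i j k, app (g z) (l z) i * L z j k + app (g z) (l z) j * L z k i
      + app (g z) (l z) k * L z i j = 0) (k : Fin 4) :
    IsNullVariation (g y) (L y) (covDeriv g L y k) (l y) (nablaVec g l y k) where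
  antisymm i j := by
    have h1 : pd k (fun z => L z i j) y = -pd k (fun z => L z j i) y := by
      rw [← pd_neg]
      exact pd_congr (hanti.mono fun z hz => hz i j)
    have h2 := hanti.self_of_nhds
    simp only [covDeriv, h1, smul_eq_mul, Fin.sum_univ_four]
    rw [h2 0 j, h2 1 j, h2 2 j, h2 3 j, h2 i 0, h2 i 1, h2 i 2, h2 i 3]
    ring
  kernel i := by
    have h0 : pd k (fun z => ∑ j, L z i j * l z j) y = 0 := pd_eq_zero (hker.mono fun z hz => hz i)
    rw [pd_sum k fun j => (hL i j).fun_mul (hl j)] at h0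
    simp only [pd_mul k (hL i _) (hl _)] at h0
    have h1 := hker.self_of_nhds
    simp only [covDeriv, nablaVec, smul_eq_mul]
    simp only [Fin.sum_univ_four] at h0 h1 ⊢
    linear_combination h0 - christoffel g 0 k i y * h1 0 - christoffel g 1 k i y * h1 1
      - christoffel g 2 k i y * h1 2 - christoffel g 3 k i y * h1 3
  wedge i j m := by
    have hd := differentiableAt_app hg hl
    have h0 : pd k (fun z => app (g z) (l z) i * L z j m + app (g z) (l z) j * L z m i
        + app (g z) (l z) m * L z i j) y = 0 := pd_eq_zero (hwedge.mono fun z hz => hz i j m)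
    rw [pd_add k (((hd i).fun_mul (hL j m)).fun_add ((hd j).fun_mul (hL m i)))
        ((hd m).fun_mul (hL i j)),
      pd_add k ((hd i).fun_mul (hL j m)) ((hd j).fun_mul (hL m i)), pd_mul k (hd i) (hL j m),
      pd_mul k (hd j) (hL m i), pd_mul k (hd m) (hL i j)] at h0
    simp only [pd_app hs hinv hg hl] at h0
    have h1 := hwedge.self_of_nhds
    have h2 : ∑ p, (christoffel g p k i y * (app (g y) (l y) p * L y j m
          + app (g y) (l y) j * L y m p + app (g y) (l y) m * L y p j)
        + christoffel g p k j y * (app (g y) (l y) i * L y p m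
          + app (g y) (l y) p * L y m i + app (g y) (l y) m * L y i p)
        + christoffel g p k m y * (app (g y) (l y) i * L y j p
          + app (g y) (l y) j * L y p i + app (g y) (l y) p * L y i j)) = 0 :=
      Finset.sum_eq_zero fun p _ => by rw [h1 p j m, h1 i p m, h1 i j p]; ring
    simp only [covDeriv, smul_eq_mul]
    simp only [Fin.sum_univ_four] at h0 h2 ⊢
    linear_combination h0 - h2

/-- The Ricci identity for the vector field `ℓ`. -/
theorem sum_riemannUp_mul (hg : ∀ i j, ContDiffAt ℝ ∞ (fun z => g z i j) y)
    (h0 : (g y).det ≠ 0) (hl : ∀ i, ContDiffAt ℝ ∞ (fun z => l z i) y) (a c d : Fin 4) :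
    ∑ b, riemannUp g a b c d y * l y b =
      pd c (fun z => nablaVec g l z d a) y - pd d (fun z => nablaVec g l z c a) y
        + ∑ m, (christoffel g a c m y * nablaVec g l y d m
          - christoffel g a d m y * nablaVec g l y c m) := by
  have hdl : ∀ i, DifferentiableAt ℝ (fun z => l z i) y :=
    fun i => (hl i).differentiableAt (by simp)
  have hdΓ : ∀ k i j, DifferentiableAt ℝ (christoffel g k i j) y := fun k i j =>
    (contDiffAt_christoffel hg h0 k i j).differentiableAt (by simp)
  have key : ∀ c d, pd c (fun z => nablaVec g l z d a) y = pd c (pd d fun z => l z a) y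
      + ∑ m, (pd c (christoffel g a d m) y * l y m
        + christoffel g a d m y * pd c (fun z => l z m) y) := by
    intro c d
    simp only [nablaVec]
    have h1 := pd_add c (((contDiffAt_pd d (hl a)).differentiableAt (by simp)))
      (DifferentiableAt.fun_sum fun m (_ : m ∈ Finset.univ) => (hdΓ a d m).fun_mul (hdl m))
    have h2 := pd_sum c fun m => (hdΓ a d m).fun_mul (hdl m)
    refine h1.trans ?_
    congr 1
    refine h2.trans (Finset.sum_congr rfl fun m _ => pd_mul c (hdΓ a d m) (hdl m))
  rw [key c d, key d c, pd_comm c d (hl a)]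
  simp only [nablaVec, riemannUp, Fin.sum_univ_four]
  ring

/-- Let `∇ℓ` have the form `ℓ ⊗ P + q ⊗ ℓ`, that is, let the line spanned by `ℓ` be parallel along
the orthogonal distribution of `ℓ`, which is then integrable. Then the curvature along this
distribution keeps the line: `R(X, Y)ℓ` is proportional to `ℓ` for `X`, `Y` orthogonal to `ℓ`. -/
theorem exists_sum_riemannUp_mul_eq (hs : ∀ z i j, g z i j = g z j i) (hinv : g y * (g y)⁻¹ = 1)
    (hg : ∀ i j, ContDiffAt ℝ ∞ (fun z => g z i j) y)
    (h0 : (g y).det ≠ 0) (hl : ∀ i, ContDiffAt ℝ ∞ (fun z => l z i) y) {P q : E4 → Fin 4 → ℝ}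
    (hP : ∀ i, DifferentiableAt ℝ (fun z => P z i) y)
    (hq : ∀ i, DifferentiableAt ℝ (fun z => q z i) y)
    (h : ∀ᶠ z in 𝓝 y, ∀ k a, nablaVec g l z k a = app (g z) (l z) k * P z a + q z k * l z a) :
    ∃ V D : Arr2 ℝ, ∀ a c d, ∑ b, riemannUp g a b c d y * l y b
      = app (g y) (l y) d * V c a - app (g y) (l y) c * V d a + l y a * D c d := by
  have hdl : ∀ i, DifferentiableAt ℝ (fun z => l z i) y :=
    fun i => (hl i).differentiableAt (by simp)
  have hdg : ∀ i j, DifferentiableAt ℝ (fun z => g z i j) y :=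
    fun i j => (hg i j).differentiableAt (by simp)
  have hd := differentiableAt_app hdg hdl
  have hy := h.self_of_nhds
  refine ⟨fun c a => pd c (fun z => P z a) y + ∑ m, christoffel g a c m y * P y m
    - app (g y) (P y) c * P y a, fun c d => pd c (fun z => q z d) y - pd d (fun z => q z c) y,
    fun a c d => ?_⟩
  have key : ∀ c d, pd c (fun z => nablaVec g l z d a) y =
      (app (g y) (nablaVec g l y c) d + ∑ m, christoffel g m c d y * app (g y) (l y) m) * P y a
        + app (g y) (l y) d * pd c (fun z => P z a) y
        + (pd c (fun z => q z d) y * l y a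
          + q y d * (nablaVec g l y c a - ∑ m, christoffel g a c m y * l y m)) := by
    intro c d
    have e : (fun z => nablaVec g l z d a) =ᶠ[𝓝 y]
        fun z => app (g z) (l z) d * P z a + q z d * l z a := h.mono fun z hz => hz d a
    rw [pd_congr e, pd_add c ((hd d).fun_mul (hP a)) ((hq d).fun_mul (hdl a)),
      pd_mul c (hd d) (hP a),
      pd_mul c (hq d) (hdl a), pd_app hs hinv hdg hdl]
    simp only [nablaVec]
    ring
  have hlow : ∀ c d, app (g y) (nablaVec g l y c) d
      = app (g y) (l y) c * app (g y) (P y) d + q y c * app (g y) (l y) d := by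
    intro c d
    simp only [app, hy]
    simp only [Fin.sum_univ_four]
    ring
  have hΓ : ∀ m, christoffel g m d c y = christoffel g m c d y := fun m => by
    rw [christoffel_symm hs]
  rw [sum_riemannUp_mul hg h0 hl, key c d, key d c]
  simp only [hlow, hy, hΓ]
  simp only [Fin.sum_univ_four]
  ring

/-- The first Bianchi identity. -/
theorem riemannUp_cyclic (hs : ∀ z i j, g z i j = g z j i) (a b c d : Fin 4) (y : E4) :
    riemannUp g a b c d y + riemannUp g a c d b y + riemannUp g a d b c y = 0 := by
  simp only [riemannUp, Fin.sum_univ_four]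
  rw [christoffel_symm hs a d b, christoffel_symm hs a c b, christoffel_symm hs a d c]
  have := fun m => christoffel_symm hs m d b
  have := fun m => christoffel_symm hs m c b
  have := fun m => christoffel_symm hs m d c
  simp only [*]
  ring

end Connection

/-! ### The algebraic consequences of `φ₁ = φ₂ = 0` -/

/-- The contraction `vᵏ b_{ka}`; for `b = ∇ℓ` this is `∇ᵥℓ`. -/
def along (b : Arr2 ℝ) (v : Fin 4 → ℝ) : Fin 4 → ℝ := fun a => ∑ k, v k * b k a

theorem pair_along (g b : Arr2 ℝ) (v w : Fin 4 → ℝ) :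
    pair g (along b v) w = ∑ k, v k * pair g (b k) w := by
  simp only [pair, along, Fin.sum_univ_four]
  ring

theorem app_along (g b : Arr2 ℝ) (v : Fin 4 → ℝ) (i : Fin 4) :
    app g (along b v) i = ∑ k, v k * app g (b k) i := by
  simp only [app, along, Fin.sum_univ_four]
  ring

theorem IsNullVariation.along {g : Matrix (Fin 4) (Fin 4) ℝ} {L : Arr2 ℝ} {T : Fin 4 → Arr2 ℝ}
    {l : Fin 4 → ℝ} {b : Arr2 ℝ} (h : ∀ k, IsNullVariation g L (T k) l (b k)) (v : Fin 4 → ℝ) :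
    IsNullVariation g L (fun i j => ∑ k, v k * T k i j) l (along b v) where
  antisymm i j := by
    rw [← Finset.sum_neg_distrib]
    exact Finset.sum_congr rfl fun k _ => by rw [(h k).antisymm i j]; ring
  kernel i := by
    have h0 : ∑ k, v k * ∑ j, (T k i j * l j + L i j * b k j) = 0 :=
      Finset.sum_eq_zero fun k _ => by rw [(h k).kernel i, mul_zero]
    rw [← h0]
    simp only [TypeNSpacetime.along, Fin.sum_univ_four]
    ring
  wedge i j m := by
    have h0 : ∑ k, v k * (app g (b k) i * L j m + app g l i * T k j m
        + (app g (b k) j * L m i + app g l j * T k m i)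
        + (app g (b k) m * L i j + app g l m * T k i j)) = 0 :=
      Finset.sum_eq_zero fun k _ => by rw [(h k).wedge i j m, mul_zero]
    rw [← h0]
    rw [app_along g, app_along g, app_along g]
    simp only [Fin.sum_univ_four]
    ring

/-- A 2-form proportional to `ℓ ∧ e` with `e` orthogonal to `ℓ` satisfies the linear relations
`L(ℓ) = 0` and `ℓ ∧ L = 0`. -/
theorem relations_of_wedge {g : Matrix (Fin 4) (Fin 4) ℝ} {L : Arr2 ℝ} {l e : Fin 4 → ℝ} {c : ℝ}
    (hL : ∀ i j, L i j = c * (app g l i * app g e j - app g l j * app g e i))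
    (hl : pair g l l = 0) (he : pair g l e = 0) :
    (∀ i j, L i j = -L j i) ∧ (∀ i, ∑ j, L i j * l j = 0) ∧
    ∀ i j k, app g l i * L j k + app g l j * L k i + app g l k * L i j = 0 := by
  refine ⟨fun i j => by rw [hL, hL j i]; ring, fun i => ?_, fun i j k => by simp only [hL]; ring⟩
  rw [pair_eq_sum_app g] at hl he
  simp only [hL]
  simp only [Fin.sum_univ_four] at hl he ⊢
  linear_combination c * app g l i * he - c * app g e i * hl

theorem nablaBiv_eq {g : E4 → Matrix (Fin 4) (Fin 4) ℝ} {η : E4 → Arr4 ℝ} {L : E4 → Arr2 ℝ}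
    {y : E4} (hL : ∀ i j, DifferentiableAt ℝ (fun z => L z i j) y)
    (hH : ∀ i j, DifferentiableAt ℝ (fun z => hodge (g z) (η z) (L z) i j) y) (v : Fin 4 → ℝ) :
    nablaBiv g η L v y = fun i j =>
      (((∑ k, v k * covDeriv g L y k i j : ℝ) : ℂ) - Complex.I *
        ((∑ k, v k * covDeriv g (fun z => hodge (g z) (η z) (L z)) y k i j : ℝ) : ℂ))
        / ((Real.sqrt 2 : ℝ) : ℂ) := by
  funext i j
  have key : ∀ k, covDeriv g (fun z => bivector (g z) (η z) (L z)) y k i j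
      = ((covDeriv g L y k i j : ℝ) - Complex.I *
        ((covDeriv g (fun z => hodge (g z) (η z) (L z)) y k i j : ℝ) : ℂ))
        / ((Real.sqrt 2 : ℝ) : ℂ) := by
    intro k
    simp only [covDeriv, bivector, pd_ofReal_sub_I_mul k (hL i j) (hH i j), Complex.real_smul,
      smul_eq_mul]
    push_cast
    simp only [Fin.sum_univ_four]
    ring
  simp only [nablaBiv, key, Complex.real_smul]
  push_cast
  simp only [Fin.sum_univ_four]
  ring

section FamilyC2

open Filter Topology

variable {g : E4 → Matrix (Fin 4) (Fin 4) ℝ} {η : E4 → Arr4 ℝ} {L : E4 → Arr2 ℝ}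
  {l : E4 → Fin 4 → ℝ} {y : E4}

/-- A time-like vector is not orthogonal to `ℓ`. -/
theorem IsAdapted.pair_ne_zero {g : Matrix (Fin 4) (Fin 4) ℝ} {L H : Arr2 ℝ} {l : Fin 4 → ℝ}
    {E : Arr2 ℝ} {ε : ℝ} (hA : IsAdapted g L H l E ε) {x : Fin 4 → ℝ} (hx : pair g x x < 0) :
    pair g l x ≠ 0 := by
  intro h
  have hE := hA.frame
  have h1 := hE.sum_mul_raise (app g x) (app g x)
  rw [raise_app hE.inv_mul] at h1
  have h2 : ∑ i, app g x i * x i = pair g x x := by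
    rw [pair_eq_sum_app g]
    exact Finset.sum_congr rfl fun i _ => mul_comm _ _
  have h3 : ∑ a, E 0 a * app g x a = 0 := by
    rw [hA.zero_eq, ← h, pair_eq_sum_app g]
  rw [h2, h3] at h1
  nlinarith [sq_nonneg (∑ a, E 2 a * app g x a), sq_nonneg (∑ a, E 3 a * app g x a)]

/-- Where `φ₁ = φ₂ = 0`, the vectors `∇_X ℓ` with `X` orthogonal to `ℓ` are proportional to `ℓ`:
`φ₁ = 0` says that `ℓ` is geodesic, so that the covectors `a = (∇ℓ, e₂)` and `a* = ε (∇ℓ, e₃)` are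
orthogonal to `ℓ`; and `φ₂ = 0` says that they are null, hence proportional to `ℓ`. -/
theorem pair_along_nablaVec_eq_zero (hs : ∀ z i j, g z i j = g z j i)
    (hg : ∀ i j, DifferentiableAt ℝ (fun z => g z i j) y)
    (hl : ∀ i, DifferentiableAt ℝ (fun z => l z i) y)
    (hL : ∀ i j, DifferentiableAt ℝ (fun z => L z i j) y)
    (hH : ∀ i j, DifferentiableAt ℝ (fun z => hodge (g z) (η z) (L z) i j) y)
    (hA : ∀ᶠ z in 𝓝 y, ∃ E ε, IsAdapted (g z) (L z) (hodge (g z) (η z) (L z)) (l z) E ε)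
    {E : Arr2 ℝ} {ε : ℝ} (hAy : IsAdapted (g y) (L y) (hodge (g y) (η y) (L y)) (l y) E ε)
    (h1 : phi1 g η L l y = 0) {x : Fin 4 → ℝ} (hx : pair (g y) x x < 0)
    (h2 : phi2 g η L l y x = 0) :
    (∀ k, pair (g y) (nablaVec g l y k) (E 0) = 0) ∧
    ∀ i ∈ ({0, 2, 3} : Finset (Fin 4)), ∀ j ∈ ({2, 3} : Finset (Fin 4)),
      pair (g y) (along (nablaVec g l y) (E i)) (E j) = 0 := by
  have hE := hAy.frame
  have hinv := hE.mul_inv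
  have hcomm := pair_comm (hs y)
  have hbl : ∀ k, pair (g y) (nablaVec g l y k) (l y) = 0 :=
    pair_nablaVec_eq_zero hs hinv hg hl (hA.mono fun z ⟨E', _, h⟩ => by
      rw [← h.zero_eq]; exact h.frame 0 0)
  have hrel : ∀ z, (∃ E ε, IsAdapted (g z) (L z) (hodge (g z) (η z) (L z)) (l z) E ε) → _ ∧ _ :=
    fun z ⟨E', ε', h⟩ => And.intro
      (relations_of_wedge (L := L z) (c := 1) (fun i j => by rw [h.form, one_mul])
        (by rw [← h.zero_eq]; exact h.frame 0 0) (by rw [← h.zero_eq]; exact h.frame 0 2))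
      (relations_of_wedge (L := hodge (g z) (η z) (L z)) h.dual
        (by rw [← h.zero_eq]; exact h.frame 0 0) (by rw [← h.zero_eq]; exact h.frame 0 3))
  have hvT := isNullVariation_covDeriv hs hinv hg hl hL (hA.mono fun z h => (hrel z h).1.1)
    (hA.mono fun z h => (hrel z h).1.2.1) (hA.mono fun z h => (hrel z h).1.2.2)
  have hvS := isNullVariation_covDeriv (L := fun z => hodge (g z) (η z) (L z)) hs hinv hg hl hH
    (hA.mono fun z h => (hrel z h).2.1)
    (hA.mono fun z h => (hrel z h).2.2.1) (hA.mono fun z h => (hrel z h).2.2.2)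
  set b := nablaVec g l y with hb
  -- a null `∇ᵥℒ` forces `∇ᵥℓ` to be proportional to `ℓ`
  have main : ∀ v, form2C (g y) (nablaBiv g η L v y) (nablaBiv g η L v y) = 0 →
      pair (g y) (along b v) (E 2) = 0 ∧ pair (g y) (along b v) (E 3) = 0 := by
    intro v hv
    rw [nablaBiv_eq hL hH] at hv
    refine hAy.components_eq_zero ?_ (IsNullVariation.along hvT v) (IsNullVariation.along hvS v) hv
    rw [pair_along (g y)]
    simp [hbl]
  have hgeo := main (l y) h1
  have hsx : pair (g y) (l y) x ≠ 0 := hAy.pair_ne_zero hx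
  have ha : aForm g L l y x = fun k => pair (g y) (b k) (E 2) := by
    funext k
    have e : ∑ i, ∑ j, covDeriv g L y k i j * l y j * x i = pair (covDeriv g L y k) x (l y) := by
      simp only [pair]
      exact Finset.sum_congr rfl fun i _ => Finset.sum_congr rfl fun j _ => by ring
    rw [aForm, e, (hvT k).pair_kernel, hAy.pair_form, hbl, hcomm x (l y)]
    field_simp
    ring
  have has : aStarForm g η L l y x = fun k => ε * pair (g y) (b k) (E 3) := by
    funext k
    have e : ∑ i, ∑ j, covDeriv g (fun z => hodge (g z) (η z) (L z)) y k i j * l y j * x i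
        = pair (covDeriv g (fun z => hodge (g z) (η z) (L z)) y k) x (l y) := by
      simp only [pair]
      exact Finset.sum_congr rfl fun i _ => Finset.sum_congr rfl fun j _ => by ring
    rw [aStarForm, e, (hvS k).pair_kernel, hAy.pair_dual, hbl, hcomm x (l y)]
    field_simp
    ring
  simp only [phi2] at h2
  have h2a := norm_eq_zero.1 ((add_eq_zero_iff_of_nonneg (norm_nonneg _) (norm_nonneg _)).1 h2).1
  have h2b := norm_eq_zero.1 ((add_eq_zero_iff_of_nonneg (norm_nonneg _) (norm_nonneg _)).1 h2).2
  rw [ha] at h2a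
  rw [has] at h2b
  -- a null covector orthogonal to `ℓ` is proportional to `ℓ`
  have null : ∀ (p : Fin 4 → ℝ), ∑ k, E 0 k * p k = 0 → ∑ k, p k * raise (g y) p k = 0 →
      ∑ k, E 2 k * p k = 0 ∧ ∑ k, E 3 k * p k = 0 := by
    intro p hp0 hpp
    rw [hE.sum_mul_raise, hp0] at hpp
    constructor <;>
      nlinarith [sq_nonneg (∑ k, E 2 k * p k), sq_nonneg (∑ k, E 3 k * p k)]
  have n2 := null (fun k => pair (g y) (b k) (E 2))
    (by rw [hAy.zero_eq, ← pair_along (g y)]; exact hgeo.1) (by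
      rw [← (main _ h2a).1, pair_along (g y)]
      exact Finset.sum_congr rfl fun k _ => mul_comm _ _)
  have n3 := null (fun k => pair (g y) (b k) (E 3))
    (by rw [hAy.zero_eq, ← pair_along (g y)]; exact hgeo.2) (by
      have h3 := (main _ h2b).2
      have e : ∑ k, pair (g y) (b k) (E 3)
          * raise (g y) (fun k => ε * pair (g y) (b k) (E 3)) k = 0 := by
        rw [← h3, pair_along (g y)]
        exact Finset.sum_congr rfl fun k _ => mul_comm _ _
      have e' : ∑ k, pair (g y) (b k) (E 3)
          * raise (g y) (fun k => ε * pair (g y) (b k) (E 3)) k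
          = ε * ∑ k, pair (g y) (b k) (E 3) * raise (g y) (fun k => pair (g y) (b k) (E 3)) k := by
        simp only [raise, Finset.mul_sum]
        exact Finset.sum_congr rfl fun i _ => Finset.sum_congr rfl fun j _ => by ring
      rw [e'] at e
      exact (mul_eq_zero.1 e).resolve_left hAy.eps_ne)
  refine ⟨fun k => by rw [hAy.zero_eq]; exact hbl k, fun i hi j hj => ?_⟩
  simp only [Finset.mem_insert, Finset.mem_singleton] at hi hj
  rcases hi with rfl | rfl | rfl <;> rcases hj with rfl | rfl
  · rw [hAy.zero_eq]; exact hgeo.1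
  · rw [hAy.zero_eq]; exact hgeo.2
  · rw [pair_along (g y)]; exact n2.1
  · rw [pair_along (g y)]; exact n3.1
  · rw [pair_along (g y)]; exact n2.2
  · rw [pair_along (g y)]; exact n3.2

end FamilyC2

/-- If `b(X)` is proportional to `ℓ` for all `X` orthogonal to `ℓ`, and `b` takes values orthogonal
to `ℓ`, then `b = ℓ ⊗ P + q ⊗ ℓ`, where `P` and `q` are explicit in terms of an auxiliary vector `x`
with `(ℓ, x) ≠ 0`. -/
theorem eq_mul_add_mul_of_frame {g : Matrix (Fin 4) (Fin 4) ℝ} (hs : ∀ i j, g i j = g j i)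
    {E : Arr2 ℝ} (hE : IsNullFrame g E) {b : Arr2 ℝ} (h0 : ∀ k, pair g (b k) (E 0) = 0)
    (hb : ∀ i ∈ ({0, 2, 3} : Finset (Fin 4)), ∀ j ∈ ({2, 3} : Finset (Fin 4)),
      pair g (along b (E i)) (E j) = 0) {x : Fin 4 → ℝ} (hx : pair g (E 0) x ≠ 0) (k a : Fin 4) :
    b k a = app g (E 0) k * (along b x a / pair g (E 0) x)
      + (pair g (b k) x - app g (E 0) k / pair g (E 0) x * pair g (along b x) x)
        / pair g (E 0) x * E 0 a := by
  have hcomm := pair_comm hs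
  -- along each `e` of the frame except `n`, the covector `(b, e)` is a multiple of `ℓ`
  have hmul : ∀ j ∈ ({0, 2, 3} : Finset (Fin 4)), (fun k => pair g (b k) (E j))
      = fun k => pair g (along b (E 1)) (E j) * app g (E 0) k := by
    intro j hj
    refine hE.ext_covector fun i => ?_
    have e : ∑ a, E i a * (pair g (along b (E 1)) (E j) * app g (E 0) a)
        = pair g (along b (E 1)) (E j) * nullGram i 0 := by
      rw [← hE.sum_mul_app, Finset.mul_sum]
      exact Finset.sum_congr rfl fun a _ => by ring
    rw [e, ← pair_along g]
    rcases Finset.mem_insert.1 hj with rfl | hj'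
    · simp [pair_along g, h0]
    · fin_cases i
      · exact (hb 0 (by decide) j hj').trans (by simp [nullGram])
      · simp [nullGram]
      · exact (hb 2 (by decide) j hj').trans (by simp [nullGram])
      · exact (hb 3 (by decide) j hj').trans (by simp [nullGram])
  set s := pair g (E 0) x with hsx
  let C : Fin 4 → ℝ := b k + (-(app g (E 0) k / s)) • along b x
  have hC : ∀ j ∈ ({0, 2, 3} : Finset (Fin 4)), pair g C (E j) = 0 := by
    intro j hj
    have e1 : pair g (b k) (E j) = pair g (along b (E 1)) (E j) * app g (E 0) k :=
      congrFun (hmul j hj) k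
    have e2 : pair g (along b x) (E j) = pair g (along b (E 1)) (E j) * s := by
      rw [pair_along g, hsx, hcomm (E 0) x, pair_eq_sum_app g x, Finset.mul_sum]
      refine Finset.sum_congr rfl fun i _ => ?_
      rw [show pair g (b i) (E j) = pair g (along b (E 1)) (E j) * app g (E 0) i from
        congrFun (hmul j hj) i]
      ring
    simp only [C, pair_add_left g, pair_smul_left g, e1, e2]
    field_simp
    ring
  have hC' : app g C = fun i => pair g C (E 1) * app g (E 0) i := by
    refine hE.ext_covector fun i => ?_
    have e : ∑ a, E i a * (pair g C (E 1) * app g (E 0) a) = pair g C (E 1) * nullGram i 0 := by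
      rw [← hE.sum_mul_app, Finset.mul_sum]
      exact Finset.sum_congr rfl fun a _ => by ring
    rw [e, ← pair_eq_sum_app g, hcomm (E i) C]
    fin_cases i
    · exact (hC 0 (by decide)).trans (by simp [nullGram])
    · simp [nullGram]
    · exact (hC 2 (by decide)).trans (by simp [nullGram])
    · exact (hC 3 (by decide)).trans (by simp [nullGram])
  have hCl : C = pair g C (E 1) • E 0 := by
    have e : (fun i => pair g C (E 1) * app g (E 0) i) = app g (pair g C (E 1) • E 0) := by
      funext i
      simp only [app, Pi.smul_apply, smul_eq_mul, Finset.mul_sum]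
      exact Finset.sum_congr rfl fun j _ => by ring
    exact (raise_app hE.inv_mul C).symm.trans
      ((congrArg (raise g) (hC'.trans e)).trans (raise_app hE.inv_mul _))
  have hq : pair g C x = pair g C (E 1) * s := by
    conv_lhs => rw [hCl]
    rw [pair_smul_left g]
  have hq' : pair g C x = pair g (b k) x - app g (E 0) k / s * pair g (along b x) x := by
    simp only [C, pair_add_left g, pair_smul_left g]
    ring
  have hCa : b k a + (-(app g (E 0) k / s)) * along b x a = pair g C (E 1) * E 0 a :=
    congrFun hCl a
  rw [← hq', hq, mul_div_assoc, div_self hx]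
  linear_combination hCa

/-! ### Curvature of type N -/

section Curvature

variable {g : E4 → Matrix (Fin 4) (Fin 4) ℝ} {y : E4}

theorem weyl_eq_of_isFundamental {g : Matrix (Fin 4) (Fin 4) ℝ} {η W : Arr4 ℝ} {L : Arr2 ℝ}
    {l : Fin 4 → ℝ} (h : IsFundamental g η W L l) (a b c d : Fin 4) :
    W a b c d = L a b * L c d - hodge g η L a b * hodge g η L c d := by
  have h2 : ((Real.sqrt 2 : ℝ) : ℂ) * ((Real.sqrt 2 : ℝ) : ℂ) = 2 := by
    rw [← Complex.ofReal_mul, Real.mul_self_sqrt (by norm_num)]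
    norm_num
  have h1 := h.2 a b c d
  simp only [selfDual, bivector] at h1
  rw [div_mul_div_comm, h2] at h1
  have h3 := congrArg Complex.re h1
  simp [Complex.mul_re, Complex.mul_im] at h3
  linarith

theorem riemannUp_eq_sum_inv_mul (hinv : (g y)⁻¹ * g y = 1) (m b c d : Fin 4) :
    riemannUp g m b c d y = ∑ a, (g y)⁻¹ m a * riemann g y a b c d := by
  have h : ∑ a, (g y)⁻¹ m a * riemann g y a b c d
      = ((g y)⁻¹.mulVec ((g y).mulVec fun m => riemannUp g m b c d y)) m := rfl
  rw [h, Matrix.mulVec_mulVec, hinv, Matrix.one_mulVec]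

/-- If the Weyl tensor is antisymmetric in its first two indices, the Ricci tensor is symmetric: its
antisymmetric part is, by the first Bianchi identity, a trace of the curvature over its first pair
of indices. -/
theorem ricci_symm (hs : ∀ z i j, g z i j = g z j i) (hinv : (g y)⁻¹ * g y = 1)
    (hW : ∀ a b c d, weyl g y a b c d = -weyl g y b a c d) (b d : Fin 4) :
    ricci g y b d = ricci g y d b := by
  have hR : ∀ a b c d, riemann g y a b c d = -riemann g y b a c d := by
    intro a b c d
    have := hW a b c d
    simp only [weyl] at this
    linarith
  have hgi : ∀ i j, (g y)⁻¹ i j = (g y)⁻¹ j i := by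
    intro i j
    have ht : (g y).transpose = g y := by ext i j; exact hs y j i
    have h1 : ((g y)⁻¹).transpose = (g y)⁻¹ := by rw [Matrix.transpose_nonsing_inv, ht]
    exact congrFun (congrFun h1 j) i
  have htr : ∀ c d, ∑ a, riemannUp g a a c d y = 0 := by
    intro c d
    have h1 : ∑ a, riemannUp g a a c d y = ∑ a, ∑ m, (g y)⁻¹ a m * riemann g y m a c d :=
      Finset.sum_congr rfl fun a _ => riemannUp_eq_sum_inv_mul hinv a a c d
    have h2 : ∑ a, ∑ m, (g y)⁻¹ a m * riemann g y m a c d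
        = -∑ a, ∑ m, (g y)⁻¹ a m * riemann g y m a c d := by
      conv_lhs => rw [Finset.sum_comm]
      simp only [← Finset.sum_neg_distrib]
      exact Finset.sum_congr rfl fun a _ => Finset.sum_congr rfl fun m _ => by
        rw [hgi m a, hR a m]; ring
    rw [h1]
    linarith
  have hanti : ∀ a, riemannUp g a d b a y = -riemannUp g a d a b y := by
    intro a
    simp only [riemannUp, Fin.sum_univ_four]
    ring
  have hsum : ∑ a, (riemannUp g a b a d y + riemannUp g a a d b y + riemannUp g a d b a y) = 0 :=
    Finset.sum_eq_zero fun a _ => riemannUp_cyclic hs a b a d y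
  simp only [Finset.sum_add_distrib, htr, hanti, Finset.sum_neg_distrib] at hsum
  simp only [ricci]
  linarith

/-- If `R(X, Y)ℓ` is proportional to `ℓ` for `X`, `Y` orthogonal to `ℓ` and the Weyl tensor
annihilates `ℓ`, then, with `q = Q(·, ℓ)`, the 3-tensor `(Z, X)q(Y) - (Z, Y)q(X)` vanishes on
vectors orthogonal to `ℓ`. -/
theorem pair_mul_sub_eq_zero {l : Fin 4 → ℝ}
    (hW : ∀ a c d, ∑ b, weyl g y a b c d * l b = 0) {V D : Arr2 ℝ}
    (hR : ∀ a c d, ∑ b, riemannUp g a b c d y * l b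
      = app (g y) l d * V c a - app (g y) l c * V d a + l a * D c d)
    {u v w : Fin 4 → ℝ} (hu : ∑ i, u i * app (g y) l i = 0) (hv : ∑ i, v i * app (g y) l i = 0)
    (hw : ∑ i, w i * app (g y) l i = 0) (hs : ∀ i j, g y i j = g y j i) :
    pair (g y) u v * ∑ i, w i * ∑ b, schouten g y b i * l b
      = pair (g y) u w * ∑ i, v i * ∑ b, schouten g y b i * l b := by
  set q : Fin 4 → ℝ := fun i => ∑ b, schouten g y b i * l b with hq
  set p := app (g y) l with hp
  obtain ⟨X, hX⟩ : ∃ X : Arr2 ℝ, ∀ a c d, g y a c * q d - g y a d * q c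
      = p d * X c a - p c * X d a + p a * D c d := by
    refine ⟨fun c a => ∑ m, g y a m * V c m - schouten g y a c, fun a c d => ?_⟩
    have h1 : ∑ b, riemann g y a b c d * l b
        = ∑ m, g y a m * ∑ b, riemannUp g m b c d y * l b := by
      simp only [riemann, Finset.sum_mul, Finset.mul_sum]
      rw [Finset.sum_comm]
      exact Finset.sum_congr rfl fun m _ => Finset.sum_congr rfl fun b _ => by ring
    have h2 := hW a c d
    have h3 : ∑ b, weyl g y a b c d * l b = ∑ b, riemann g y a b c d * l b
        - (g y a c * q d + p d * schouten g y a c - g y a d * q c - p c * schouten g y a d) := by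
      simp only [weyl, hq, hp, app, hs d, hs c]
      simp only [Fin.sum_univ_four]
      ring
    simp only [hR] at h1
    rw [h3, h1] at h2
    have h4 : p a = ∑ m, g y a m * l m := rfl
    simp only [Fin.sum_univ_four] at h2 h4 ⊢
    linear_combination -h2 - D c d * h4
  -- contraction with `w`, `v` and `u` in turn
  have s1 : ∀ a c, g y a c * (∑ i, w i * q i) - (∑ d, g y a d * w d) * q c
      = -p c * (∑ d, X d a * w d) + p a * ∑ d, D c d * w d := by
    intro a c
    have e := hX a c
    simp only [Fin.sum_univ_four] at hw ⊢
    linear_combination w 0 * e 0 + w 1 * e 1 + w 2 * e 2 + w 3 * e 3 + X c a * hw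
  have s2 : ∀ a, (∑ c, g y a c * v c) * (∑ i, w i * q i)
      - (∑ d, g y a d * w d) * (∑ i, v i * q i) = p a * ∑ c, v c * ∑ d, D c d * w d := by
    intro a
    have e := s1 a
    generalize ∑ i, w i * q i = qw at e ⊢
    generalize ∑ d, g y a d * w d = gw at e ⊢
    generalize ∑ d, X d a * w d = xw at e ⊢
    generalize (fun c => ∑ d, D c d * w d) = dw at e ⊢
    simp only [Fin.sum_univ_four] at hv e ⊢
    linear_combination v 0 * e 0 + v 1 * e 1 + v 2 * e 2 + v 3 * e 3 - xw * hv
  have e1 : pair (g y) u v = ∑ a, u a * ∑ c, g y a c * v c := pair_eq_sum_app (g y) u v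
  have e2 : pair (g y) u w = ∑ a, u a * ∑ c, g y a c * w c := pair_eq_sum_app (g y) u w
  rw [e1, e2, ← sub_eq_zero, Finset.sum_mul, Finset.sum_mul, ← Finset.sum_sub_distrib]
  have e3 : ∀ a, u a * (∑ c, g y a c * v c) * (∑ i, w i * q i)
      - u a * (∑ c, g y a c * w c) * (∑ i, v i * q i)
      = u a * p a * ∑ c, v c * ∑ d, D c d * w d := by
    intro a
    linear_combination u a * s2 a
  rw [Finset.sum_congr rfl fun a _ => e3 a, ← Finset.sum_mul, hu, zero_mul]

end Curvature

/-! ### The eigenvector property in one coordinate system -/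

section Coordinates

open Filter Topology

theorem contDiffAt_hodge {g : E4 → Matrix (Fin 4) (Fin 4) ℝ} {η : E4 → Arr4 ℝ} {L : E4 → Arr2 ℝ}
    {y : E4} (hg : ∀ i j, ContDiffAt ℝ ∞ (fun z => g z i j) y) (h0 : (g y).det ≠ 0)
    (hη : ∀ i j k m, ContDiffAt ℝ ∞ (fun z => η z i j k m) y)
    (hL : ∀ i j, ContDiffAt ℝ ∞ (fun z => L z i j) y) (i j : Fin 4) :
    ContDiffAt ℝ ∞ (fun z => hodge (g z) (η z) (L z) i j) y := by
  have hi := contDiffAt_inv hg h0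
  simp only [hodge, raise2, smul_eq_mul]
  exact contDiffAt_const.mul (ContDiffAt.sum fun c _ => ContDiffAt.sum fun d _ =>
    (hη i j c d).mul (ContDiffAt.sum fun a _ => ContDiffAt.sum fun b _ =>
      ((hi c a).mul (hi d b)).mul (hL a b)))

theorem schouten_eigenvector {g : E4 → Matrix (Fin 4) (Fin 4) ℝ} {η : E4 → Arr4 ℝ}
    {L : E4 → Arr2 ℝ} {l : E4 → Fin 4 → ℝ} {V : Set E4} (hV : IsOpen V)
    (hs : ∀ z i j, g z i j = g z j i) (hlor : ∀ z ∈ V, IsLorentzian (g z))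
    (hvol : ∀ z ∈ V, IsVolume (η z))
    (hg : ∀ i j, ContDiffOn ℝ ∞ (fun z => g z i j) V)
    (hη : ∀ i j k m, ContDiffOn ℝ ∞ (fun z => η z i j k m) V)
    (hL : ∀ i j, ContDiffOn ℝ ∞ (fun z => L z i j) V)
    (hl : ∀ i, ContDiffOn ℝ ∞ (fun z => l z i) V)
    (hfund : ∀ z ∈ V, IsFundamental (g z) (η z) (weyl g z) (L z) (l z))
    (h1 : ∀ z ∈ V, phi1 g η L l z = 0)
    (h2 : ∀ z ∈ V, ∀ x, pair (g z) x x < 0 → phi2 g η L l z x = 0) {y : E4} (hy : y ∈ V)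
    {x : Fin 4 → ℝ} (hx : pair (g y) x x < 0) :
    pair (g y) (l y) x ≠ 0 ∧ app (schouten g y) (l y)
      = (pair (schouten g y) (l y) x / pair (g y) (l y) x) • app (g y) (l y) := by
  have hnhds : ∀ z ∈ V, V ∈ 𝓝 z := fun z hz => hV.mem_nhds hz
  have hA : ∀ z ∈ V, ∃ E ε, IsAdapted (g z) (L z) (hodge (g z) (η z) (L z)) (l z) E ε :=
    fun z hz => exists_isAdapted (hlor z hz) (hvol z hz) (hfund z hz).1
  have hdet : ∀ z ∈ V, (g z).det ≠ 0 := by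
    intro z hz
    obtain ⟨E, ε, hE⟩ := hA z hz
    exact ((Matrix.isUnit_det_of_right_inverse hE.frame.mul_inv)).ne_zero
  have hgs : ∀ z ∈ V, ∀ i j, ContDiffAt ℝ ∞ (fun z => g z i j) z :=
    fun z hz i j => (hg i j).contDiffAt (hnhds z hz)
  have hls : ∀ z ∈ V, ∀ i, ContDiffAt ℝ ∞ (fun z => l z i) z :=
    fun z hz i => (hl i).contDiffAt (hnhds z hz)
  have hLs : ∀ z ∈ V, ∀ i j, ContDiffAt ℝ ∞ (fun z => L z i j) z :=
    fun z hz i j => (hL i j).contDiffAt (hnhds z hz)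
  have hHs : ∀ z ∈ V, ∀ i j, ContDiffAt ℝ ∞ (fun z => hodge (g z) (η z) (L z) i j) z :=
    fun z hz => contDiffAt_hodge (hgs z hz) (hdet z hz)
      (fun i j k m => (hη i j k m).contDiffAt (hnhds z hz)) (hLs z hz)
  obtain ⟨E, ε, hE⟩ := hA y hy
  have hsx : pair (g y) (l y) x ≠ 0 := hE.pair_ne_zero hx
  refine ⟨hsx, ?_⟩
  -- near `y`, the fixed vector `x` is not orthogonal to `ℓ`, and serves to split `∇ℓ` smoothly
  have hpairx : ∀ {w : E4 → Fin 4 → ℝ}, (∀ i, ContDiffAt ℝ ∞ (fun z => w z i) y) →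
      ContDiffAt ℝ ∞ (fun z => pair (g z) (w z) x) y := by
    intro w hw
    simp only [pair]
    exact ContDiffAt.sum fun i _ => ContDiffAt.sum fun j _ =>
      ((hgs y hy i j).mul (hw i)).mul contDiffAt_const
  have hsc := hpairx (hls y hy)
  have hne : ∀ᶠ z in 𝓝 y, pair (g z) (l z) x ≠ 0 := hsc.continuousAt.eventually_ne hsx
  have hB := contDiffAt_nablaVec (hgs y hy) (hdet y hy) (hls y hy)
  have hBx : ∀ a, ContDiffAt ℝ ∞ (fun z => along (nablaVec g l z) x a) y := fun a =>
    ContDiffAt.sum fun k _ => contDiffAt_const.mul (hB k a)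
  have happ : ∀ k, ContDiffAt ℝ ∞ (fun z => app (g z) (l z) k) y := fun k =>
    ContDiffAt.sum fun j _ => (hgs y hy k j).mul (hls y hy j)
  have hrec : ∀ᶠ z in 𝓝 y, ∀ k a, nablaVec g l z k a
      = app (g z) (l z) k * (along (nablaVec g l z) x a / pair (g z) (l z) x)
      + (pair (g z) (nablaVec g l z k) x - app (g z) (l z) k / pair (g z) (l z) x
          * pair (g z) (along (nablaVec g l z) x) x) / pair (g z) (l z) x * l z a := by
    filter_upwards [hnhds y hy, hne] with z hz hzx k a
    obtain ⟨E', ε', hE'⟩ := hA z hz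
    obtain ⟨t, ht, -⟩ := (hlor z hz).timelike
    obtain ⟨c1, c2⟩ := pair_along_nablaVec_eq_zero hs
      (fun i j => (hgs z hz i j).differentiableAt (by simp))
      (fun i => (hls z hz i).differentiableAt (by simp))
      (fun i j => (hLs z hz i j).differentiableAt (by simp))
      (fun i j => (hHs z hz i j).differentiableAt (by simp))
      (eventually_of_mem (hnhds z hz) hA) hE' (h1 z hz) ht (h2 z hz t ht)
    have := eq_mul_add_mul_of_frame (hs z) hE'.frame c1 c2 (x := x)
      (by rw [hE'.zero_eq]; exact hzx) k a
    rwa [hE'.zero_eq] at this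
  obtain ⟨X, D, hR⟩ := exists_sum_riemannUp_mul_eq hs hE.frame.mul_inv (hgs y hy) (hdet y hy)
    (hls y hy) (P := fun z a => along (nablaVec g l z) x a / pair (g z) (l z) x)
    (q := fun z k => (pair (g z) (nablaVec g l z k) x - app (g z) (l z) k / pair (g z) (l z) x
          * pair (g z) (along (nablaVec g l z) x) x) / pair (g z) (l z) x)
    (fun a => ((hBx a).div hsc hsx).differentiableAt (by simp))
    (fun k => (((hpairx (hB k)).sub (((happ k).div hsc hsx).mul (hpairx hBx))).div hsc
      hsx).differentiableAt (by simp)) hrec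
  -- the Weyl tensor is `L ⊗ L - *L ⊗ *L`
  have hWeq := weyl_eq_of_isFundamental (hfund y hy)
  obtain ⟨La, Lk, -⟩ := relations_of_wedge (L := L y) (c := 1)
    (fun i j => by rw [hE.form, one_mul])
    (by rw [← hE.zero_eq]; exact hE.frame 0 0) (by rw [← hE.zero_eq]; exact hE.frame 0 2)
  obtain ⟨Ha, Hk, -⟩ := relations_of_wedge hE.dual
    (by rw [← hE.zero_eq]; exact hE.frame 0 0) (by rw [← hE.zero_eq]; exact hE.frame 0 3)
  have hWk : ∀ a c d, ∑ b, weyl g y a b c d * l y b = 0 := by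
    intro a c d
    have e1 := Lk a
    have e2 := Hk a
    simp only [hWeq]
    simp only [Fin.sum_univ_four] at e1 e2 ⊢
    linear_combination L y c d * e1 - hodge (g y) (η y) (L y) c d * e2
  have hWa : ∀ a b c d, weyl g y a b c d = -weyl g y b a c d := by
    intro a b c d
    rw [hWeq, hWeq, La a b, Ha a b]
    ring
  have hric := ricci_symm hs hE.frame.inv_mul hWa
  have hQ : ∀ a b, schouten g y a b = schouten g y b a := by
    intro a b
    simp only [schouten, hric a b, hs y a b]
  have horth : ∀ i, i ≠ 1 → ∑ a, E i a * app (g y) (l y) a = 0 := by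
    intro i hi
    rw [← hE.zero_eq]
    refine (hE.frame.sum_mul_app i 0).trans ?_
    revert hi
    fin_cases i <;> simp [nullGram]
  have hcon := fun i j k (hi : i ≠ 1) (hj : j ≠ 1) (hk : k ≠ 1) =>
    pair_mul_sub_eq_zero hWk hR (horth i hi) (horth j hj) (horth k hk) (hs y)
  have hE' : ∀ i j, pair (g y) (E i) (E j) = nullGram i j := hE.frame
  simp only [hE'] at hcon
  have hq : (fun i => ∑ b, schouten g y b i * l y b) = app (schouten g y) (l y) := by
    funext i
    exact Finset.sum_congr rfl fun b _ => by rw [hQ]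
  have hqi := congrFun hq
  simp only [hqi] at hcon
  have q0 := hcon 2 2 0 (by decide) (by decide) (by decide)
  have q2 := hcon 3 3 2 (by decide) (by decide) (by decide)
  have q3 := hcon 2 2 3 (by decide) (by decide) (by decide)
  simp [nullGram] at q0 q2 q3
  obtain ⟨lam, hlam⟩ : ∃ lam : ℝ, app (schouten g y) (l y) = fun a => lam * app (g y) (l y) a := by
    refine ⟨∑ a, E 1 a * app (schouten g y) (l y) a, hE.frame.ext_covector fun i => ?_⟩
    have e : ∑ a, E i a * ((∑ a, E 1 a * app (schouten g y) (l y) a) * app (g y) (l y) a)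
        = (∑ a, E 1 a * app (schouten g y) (l y) a) * nullGram i 0 := by
      rw [← hE.frame.sum_mul_app i 0, hE.zero_eq, Finset.mul_sum]
      exact Finset.sum_congr rfl fun a _ => by ring
    rw [e]
    fin_cases i
    · exact q0.trans (by simp [nullGram])
    · simp [nullGram]
    · exact q2.trans (by simp [nullGram])
    · exact q3.trans (by simp [nullGram])
  have hval : pair (schouten g y) (l y) x = lam * pair (g y) (l y) x := by
    rw [pair_comm hQ, pair_comm (hs y), pair_eq_sum_app, hlam, pair_eq_sum_app (g y),
      Finset.mul_sum]
    exact Finset.sum_congr rfl fun a _ => by ring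
  rw [hval, mul_div_assoc, div_self hsx, mul_one, hlam]
  rfl

end Coordinates

/-! ### Components of a spacetime in a chart -/

section LinearAlgebra

variable {X : Type*} [AddCommGroup X] [Module ℝ X]

theorem isLorentzian_of_basis (G : X →ₗ[ℝ] X →ₗ[ℝ] ℝ) (b : Module.Basis (Fin 4) ℝ X)
    (hb : ∀ i j, G (b i) (b j) = Matrix.diagonal ![(-1 : ℝ), 1, 1, 1] i j)
    (Φ : (Fin 4 → ℝ) ≃ₗ[ℝ] X) (g : Matrix (Fin 4) (Fin 4) ℝ)
    (hg : ∀ i j, g i j = G (Φ (Pi.single i 1)) (Φ (Pi.single j 1))) : IsLorentzian g := by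
  have hsum : ∀ v w : X, G v w = ∑ i, ∑ j, b.repr v i * (b.repr w j * G (b i) (b j)) := by
    intro v w
    conv_lhs => rw [← b.sum_repr v, ← b.sum_repr w]
    simp only [map_sum, map_smul, LinearMap.sum_apply, LinearMap.smul_apply, smul_eq_mul,
      Finset.mul_sum]
    rw [Finset.sum_comm]
    exact Finset.sum_congr rfl fun i _ => Finset.sum_congr rfl fun j _ => by ring
  have hG : ∀ v w : X, G v w = -(b.repr v 0 * b.repr w 0) + b.repr v 1 * b.repr w 1
      + b.repr v 2 * b.repr w 2 + b.repr v 3 * b.repr w 3 := by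
    intro v w
    rw [hsum]
    simp [hb, Fin.sum_univ_four, Matrix.diagonal_apply]
  have hpair : ∀ v w, pair g v w = G (Φ v) (Φ w) := by
    intro v w
    conv_rhs => rw [← Finset.univ_sum_single v, ← Finset.univ_sum_single w]
    have hsingle : ∀ (v : Fin 4 → ℝ) i, (Pi.single i (v i) : Fin 4 → ℝ)
        = v i • Pi.single i (1 : ℝ) := by
      intro v i
      rw [← Pi.single_smul, smul_eq_mul, mul_one]
    simp only [hsingle, map_sum, map_smul, LinearMap.sum_apply, LinearMap.smul_apply, smul_eq_mul,
      pair, hg, Finset.mul_sum]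
    rw [Finset.sum_comm]
    exact Finset.sum_congr rfl fun i _ => Finset.sum_congr rfl fun j _ => by ring
  refine ⟨fun i j => by rw [hg, hg, hG, hG]; ring, Φ.symm (b 0), ?_, fun v hv hv0 => ?_⟩
  · rw [hpair, Φ.apply_symm_apply, hb]
    simp
  · rw [hpair, Φ.apply_symm_apply, hG] at hv
    rw [hpair, hG]
    have h0 : b.repr (Φ v) 0 = 0 := by simpa using hv
    by_contra hle
    have hz : b.repr (Φ v) 1 = 0 ∧ b.repr (Φ v) 2 = 0 ∧ b.repr (Φ v) 3 = 0 := by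
      rw [h0] at hle
      refine ⟨?_, ?_, ?_⟩ <;>
        nlinarith [mul_self_nonneg (b.repr (Φ v) 1), mul_self_nonneg (b.repr (Φ v) 2),
          mul_self_nonneg (b.repr (Φ v) 3)]
    apply hv0
    have h1 : b.repr (Φ v) = 0 := by
      ext i
      fin_cases i
      · exact h0
      · exact hz.1
      · exact hz.2.1
      · exact hz.2.2
    simpa using h1

theorem isVolume_of_basis (f : X [⋀^Fin 4]→ₗ[ℝ] ℝ) (b : Module.Basis (Fin 4) ℝ X)
    (hb : f b ^ 2 = 1) (Φ : (Fin 4 → ℝ) ≃ₗ[ℝ] X) (η : Arr4 ℝ)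
    (hη : ∀ i j k m, η i j k m = f ![Φ (Pi.single i 1), Φ (Pi.single j 1), Φ (Pi.single k 1),
      Φ (Pi.single m 1)]) : IsVolume η := by
  refine ⟨f.compLinearMap Φ.toLinearMap, fun h => ?_, fun i j k m => ?_⟩
  · have h1 : f.compLinearMap Φ.toLinearMap (fun i => Φ.symm (b i)) = 0 := by rw [h]; rfl
    have h2 : f.compLinearMap Φ.toLinearMap (fun i => Φ.symm (b i)) = f b := by
      rw [AlternatingMap.compLinearMap_apply]
      congr 1
      funext i
      simp
    rw [← h2, h1] at hb
    norm_num at hb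
  · rw [hη, AlternatingMap.compLinearMap_apply]
    congr 1
    funext i
    fin_cases i <;> rfl

end LinearAlgebra

section Manifold

variable {M : Type*} [TopologicalSpace M] [ChartedSpace E4 M]

/-- The coordinate vectors of a chart form a basis of the tangent space. -/
theorem exists_equiv_coordVec {e : OpenPartialHomeomorph M E4}
    (he : e ∈ IsManifold.maximalAtlas 𝓘(ℝ, E4) ∞ M) {y : E4} (hy : y ∈ e.target) :
    ∃ Φ : (Fin 4 → ℝ) ≃ₗ[ℝ] TangentSpace 𝓘(ℝ, E4) (e.symm y),
      ∀ i, Φ (Pi.single i 1) = coordVec e y i := by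
  have hd : e.MDifferentiable 𝓘(ℝ, E4) 𝓘(ℝ, E4) :=
    ⟨(contMDiffOn_of_mem_maximalAtlas he).mdifferentiableOn (by simp),
      (contMDiffOn_symm_of_mem_maximalAtlas he).mdifferentiableOn (by simp)⟩
  have hbij := hd.symm.mfderiv_bijective (x := y) hy
  exact ⟨(WithLp.linearEquiv 2 ℝ (Fin 4 → ℝ)).symm.trans
    (LinearEquiv.ofBijective (mfderiv 𝓘(ℝ, E4) 𝓘(ℝ, E4) e.symm y).toLinearMap hbij),
    fun i => rfl⟩

variable [IsManifold 𝓘(ℝ, E4) ∞ M]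

theorem Spacetime.isLorentzian (S : Spacetime M) {e : OpenPartialHomeomorph M E4}
    (he : e ∈ IsManifold.maximalAtlas 𝓘(ℝ, E4) ∞ M) {y : E4} (hy : y ∈ e.target) :
    IsLorentzian (comp2 S.g e y) := by
  obtain ⟨Φ, hΦ⟩ := exists_equiv_coordVec he hy
  obtain ⟨b, hb⟩ := S.lorentzian (e.symm y)
  exact isLorentzian_of_basis (S.g (e.symm y)) b hb Φ _ fun i j => by rw [hΦ, hΦ]; rfl

theorem Spacetime.isVolume (S : Spacetime M) {e : OpenPartialHomeomorph M E4}
    (he : e ∈ IsManifold.maximalAtlas 𝓘(ℝ, E4) ∞ M) {y : E4} (hy : y ∈ e.target) :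
    IsVolume (comp4 S.vol e y) := by
  obtain ⟨Φ, hΦ⟩ := exists_equiv_coordVec he hy
  obtain ⟨b, hb⟩ := S.lorentzian (e.symm y)
  exact isVolume_of_basis (S.vol (e.symm y)) b (S.vol_sq _ b hb) Φ _ fun i j k m => by
    rw [hΦ, hΦ, hΦ, hΦ]; rfl

theorem Spacetime.comp2_symm (S : Spacetime M) (e : OpenPartialHomeomorph M E4) (z : E4)
    (i j : Fin 4) : comp2 S.g e z i j = comp2 S.g e z j i := by
  obtain ⟨b, hb⟩ := S.lorentzian (e.symm z)
  have h : S.g (e.symm z) = (S.g (e.symm z)).flip := by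
    refine b.ext fun i => b.ext fun j => ?_
    rw [LinearMap.flip_apply, hb, hb]
    fin_cases i <;> fin_cases j <;> simp
  have := congrArg (fun G => G (coordVec e z i) (coordVec e z j)) h
  exact this

end Manifold

end TypeNSpacetime

end

open TypeNSpacetime
theorem mainTheorem9 {M : Type*} [TopologicalSpace M] [ChartedSpace E4 M]
    [IsManifold 𝓘(ℝ, E4) ∞ M] (S : Spacetime M)
    (U : Set M) (hU : IsOpen U) (L : BilinField M) (l : VecField M)
    (hfund : IsFundamentalOn S U L l) (hC2 : InFamilyC2 S U L l) :
    ∀ e ∈ IsManifold.maximalAtlas 𝓘(ℝ, E4) ∞ M, ∀ y ∈ e.target ∩ e.symm ⁻¹' U,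
      compV l e y ≠ 0 ∧
      ∀ x : Fin 4 → ℝ, pair (comp2 S.g e y) x x < 0 →
        pair (comp2 S.g e y) (compV l e y) x ≠ 0 ∧
        ∀ lam : ℝ, lam = pair (schouten (comp2 S.g e) y) (compV l e y) x
              / pair (comp2 S.g e y) (compV l e y) x →
          app (schouten (comp2 S.g e) y) (compV l e y)
              = lam • app (comp2 S.g e y) (compV l e y) ∧
          app (ricci (comp2 S.g e) y) (compV l e y)
              = (2 * lam + scalarCurv (comp2 S.g e) y / 6)
                  • app (comp2 S.g e y) (compV l e y) := by
  intro e he y hy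
  have hsub : e.target ∩ e.symm ⁻¹' U ⊆ e.target := Set.inter_subset_left
  refine ⟨(hfund.fundamental e he y hy).1.ne_zero, fun x hx => ?_⟩
  obtain ⟨hne, hQ⟩ := schouten_eigenvector (e.isOpen_inter_preimage_symm hU) (S.comp2_symm e)
    (fun z hz => S.isLorentzian he hz.1) (fun z hz => S.isVolume he hz.1)
    (fun i j => (S.smooth_g e he i j).mono hsub)
    (fun i j k m => (S.smooth_vol e he i j k m).mono hsub) (hfund.smooth_form e he)
    (hfund.smooth_vec e he) (hfund.fundamental e he) (fun z hz => (hC2 e he z hz).2.1)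
    (fun z hz => (hC2 e he z hz).2.2) hy hx
  refine ⟨hne, fun lam hlam => ?_⟩
  rw [← hlam] at hQ
  refine ⟨hQ, ?_⟩
  funext i
  have hi := congrFun hQ i
  simp only [Pi.smul_apply, smul_eq_mul] at hi ⊢
  have h : app (ricci (comp2 S.g e) y) (compV l e y) i
      = 2 * app (schouten (comp2 S.g e) y) (compV l e y) i
        + scalarCurv (comp2 S.g e) y / 6 * app (comp2 S.g e y) (compV l e y) i := by
    simp only [app, schouten, Finset.mul_sum, ← Finset.sum_add_distrib]
    exact Finset.sum_congr rfl fun j _ => by ring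
  rw [h, hi]
  ring
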